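/- For integers $0\le s\le N$ let $\mathbb R^N_s$ be $\mathbb R^N$ with the scalar product $\langle x,y\rangle=-\sum_{i=1}^{s}x_iy_i+\sum_{i=s+1}^{N}x_iy_i$, and let $S^n_s=\{x\in\mathbb R^{n+1}_s:\langle x,x\rangle=1\}$ and $H^n_s=\{x\in\mathbb R^{n+1}_{s+1}:\langle x,x\rangle=-1\}$, each with the induced pseudo-Riemannian metric of signature $(s,n-s)$ ($s$ negative directions). For $R>0$ let $S^m(R)$ be the round sphere of radius $R$ in Euclidean $\mathbb R^{m+1}$. A smooth ($C^\infty$) isometric immersion has flat normal bundle if the curvature $R^\perp(X,Y)\xi=\nabla^\perp_X\nabla^\perp_Y\xi-\nabla^\perp_Y\nabla^\perp_X\xi-\nabla^\perp_{[X,Y]}\xi$ of its normal connection $\nabla^\perp$ vanishes for all smooth vector fields $X,Y$ and all smooth normal fields $\xi$. Let $m\ge 1$. 1. For every $R>0$ there is no smooth isometric immersion with flat normal bundle of the whole sphere $S^m(R)$ into $H^{2m-1}_{m-1}$. 2. For every $R$ with $0<R<1$ there is no smooth isometric immersion with flat normal bundle of the whole sphere $S^m(R)$ into $S^{2m-1}_{m-1}$.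 -/

import Mathlib

open scoped Manifold ContDiff

noncomputable section

/-! ### Pseudo-Riemannian space forms -/

/-- The scalar product of the pseudo-Euclidean space `ℝ^N_s`, with matrix `diag(-I_s, I_{N-s})`. -/
def pseudoForm (N s : ℕ) : LinearMap.BilinForm ℝ (Fin N → ℝ) :=
  Matrix.toBilin' (Matrix.diagonal fun i : Fin N => if i.val < s then (-1 : ℝ) else 1)

theorem pseudoForm_apply (N s : ℕ) (v w : Fin N → ℝ) :
    pseudoForm N s v w = ∑ i : Fin N, (if i.val < s then (-1 : ℝ) else 1) * v i * w i := by
  simp only [pseudoForm, Matrix.toBilin'_apply', dotProduct, Matrix.mulVec_diagonal]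
  exact Finset.sum_congr rfl fun i _ => by ring

theorem pseudoForm_comm (N s : ℕ) (v w : Fin N → ℝ) :
    pseudoForm N s v w = pseudoForm N s w v := by
  simp only [pseudoForm_apply]
  exact Finset.sum_congr rfl fun i _ => by ring

/-- The pseudo-Riemannian sphere `S^n_s`, a quadric in `ℝ^{n+1}_s`. -/
def pseudoSphere (n s : ℕ) : Set (Fin (n + 1) → ℝ) :=
  {x | pseudoForm (n + 1) s x x = 1}

/-- The pseudo-Riemannian hyperbolic space `H^n_s`, a quadric in `ℝ^{n+1}_{s+1}`. -/
def pseudoHyperbolic (n s : ℕ) : Set (Fin (n + 1) → ℝ) :=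
  {x | pseudoForm (n + 1) (s + 1) x x = -1}

/-! ### The round sphere of radius `R` -/

/-- The smooth manifold underlying all the spheres `S^m(R)`. -/
abbrev SphereManifold (m : ℕ) : Type :=
  Metric.sphere (0 : EuclideanSpace ℝ (Fin (m + 1))) 1

/-- The standard parametrization `x ↦ R x` of the sphere of radius `R` about the origin. -/
def sphereEmbedding (m : ℕ) (R : ℝ) (x : SphereManifold m) : EuclideanSpace ℝ (Fin (m + 1)) :=
  R • (x : EuclideanSpace ℝ (Fin (m + 1)))

theorem range_sphereEmbedding (m : ℕ) {R : ℝ} (hR : 0 < R) :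
    Set.range (sphereEmbedding m R) =
      Metric.sphere (0 : EuclideanSpace ℝ (Fin (m + 1))) R := by
  ext y
  simp only [Set.mem_range, mem_sphere_zero_iff_norm, sphereEmbedding]
  constructor
  · rintro ⟨x, rfl⟩
    rw [norm_smul, mem_sphere_zero_iff_norm.1 x.2, Real.norm_of_nonneg hR.le, mul_one]
  · intro hy
    refine ⟨⟨R⁻¹ • y, ?_⟩, ?_⟩
    · rw [mem_sphere_zero_iff_norm, norm_smul, hy, norm_inv, Real.norm_of_nonneg hR.le,
        inv_mul_cancel₀ hR.ne']
    · simp [smul_smul, hR.ne']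

/-- The differential at `x` of the parametrization of the sphere of radius `R`. -/
def sphereEmbeddingDeriv (m : ℕ) (R : ℝ) (x : SphereManifold m) :
    TangentSpace (𝓡 m) x →L[ℝ] EuclideanSpace ℝ (Fin (m + 1)) :=
  mfderiv (𝓡 m) 𝓘(ℝ, EuclideanSpace ℝ (Fin (m + 1))) (sphereEmbedding m R) x

/-- The Riemannian metric of `S^m(R)`: the metric induced from Euclidean space by the
parametrization `x ↦ R x` of the sphere of radius `R`. -/
def sphereMetric (m : ℕ) (R : ℝ) (x : SphereManifold m) (v w : TangentSpace (𝓡 m) x) : ℝ :=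
  inner ℝ (sphereEmbeddingDeriv m R x v) (sphereEmbeddingDeriv m R x w)

/-! ### Isometric immersions into quadrics and their normal bundles

Throughout, `B` is the scalar product of the ambient space `ℝ^N`, and a map from a manifold `M`
into a quadric `Q = {x | B x x = ±1}` is written as a map `M → ℝ^N`. -/

section Immersions

variable {m N : ℕ} {M : Type*} [TopologicalSpace M] [ChartedSpace (EuclideanSpace ℝ (Fin m)) M]

/-- The differential at `x` of a map with values in `ℝ^N`. -/
def ambientDeriv (f : M → (Fin N → ℝ)) (x : M) : TangentSpace (𝓡 m) x →L[ℝ] (Fin N → ℝ) :=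
  mfderiv (𝓡 m) 𝓘(ℝ, Fin N → ℝ) f x

/-- `f` is a smooth isometric immersion of `(M, g)` into the quadric `Q`, whose
pseudo-Riemannian metric is the restriction of `B`. -/
structure IsIsometricImmersion (g : ∀ x : M, TangentSpace (𝓡 m) x → TangentSpace (𝓡 m) x → ℝ)
    (B : LinearMap.BilinForm ℝ (Fin N → ℝ)) (Q : Set (Fin N → ℝ))
    (f : M → (Fin N → ℝ)) : Prop where
  contMDiff : ContMDiff (𝓡 m) 𝓘(ℝ, Fin N → ℝ) ∞ f
  mem : ∀ x, f x ∈ Q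
  injective : ∀ x, Function.Injective (ambientDeriv (m := m) f x)
  isometric : ∀ x (v w : TangentSpace (𝓡 m) x),
    B (ambientDeriv f x v) (ambientDeriv f x w) = g x v w

/-- The span of the position vector `f x` (the `B`-normal of the quadric at `f x`) and of the
tangent space `df_x(T_x M)`. -/
def tangentialSpace (m : ℕ) [ChartedSpace (EuclideanSpace ℝ (Fin m)) M]
    (f : M → (Fin N → ℝ)) (x : M) : Submodule ℝ (Fin N → ℝ) :=
  Submodule.span ℝ {f x} ⊔ LinearMap.range (ambientDeriv (m := m) f x).toLinearMap

/-- The normal space at `x` of `f` as an immersion into the quadric: the vectors that are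
tangent to the quadric at `f x` and `B`-orthogonal to `df_x(T_x M)`. -/
def normalSpace (m : ℕ) [ChartedSpace (EuclideanSpace ℝ (Fin m)) M]
    (B : LinearMap.BilinForm ℝ (Fin N → ℝ)) (f : M → (Fin N → ℝ)) (x : M) :
    Submodule ℝ (Fin N → ℝ) :=
  B.orthogonal (tangentialSpace m f x)

theorem mem_normalSpace_iff (B : LinearMap.BilinForm ℝ (Fin N → ℝ)) (f : M → (Fin N → ℝ)) (x : M)
    (w : Fin N → ℝ) :
    w ∈ normalSpace m B f x ↔
      B (f x) w = 0 ∧ ∀ v : TangentSpace (𝓡 m) x, B (ambientDeriv f x v) w = 0 := by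
  unfold normalSpace tangentialSpace
  rw [LinearMap.BilinForm.mem_orthogonal_iff]
  constructor
  · intro h
    exact ⟨h _ (Submodule.mem_sup_left (Submodule.mem_span_singleton_self _)),
      fun v => h _ (Submodule.mem_sup_right ⟨v, rfl⟩)⟩
  · rintro ⟨h1, h2⟩ n hn
    obtain ⟨a, ha, b, ⟨v, rfl⟩, rfl⟩ := Submodule.mem_sup.1 hn
    obtain ⟨c, rfl⟩ := Submodule.mem_span_singleton.1 ha
    change B (c • f x + ambientDeriv f x v) w = 0
    simp [h1, h2 v]

open Classical in
/-- The `B`-orthogonal projection of `ℝ^N` onto the normal space at `x`. For an isometric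
immersion of a Riemannian manifold the two subspaces are complementary
(`IsIsometricImmersion.isCompl`); the default value `0` then plays no role. -/
def normalProj (m : ℕ) [ChartedSpace (EuclideanSpace ℝ (Fin m)) M]
    (B : LinearMap.BilinForm ℝ (Fin N → ℝ)) (f : M → (Fin N → ℝ)) (x : M) :
    (Fin N → ℝ) →ₗ[ℝ] (Fin N → ℝ) :=
  if h : IsCompl (normalSpace m B f x) (tangentialSpace m f x) then
    Submodule.projection (normalSpace m B f x) (tangentialSpace m f x) h
  else 0

/-- The position vector of an immersion into a quadric `B y y = c` is orthogonal to it. -/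
theorem IsIsometricImmersion.orthogonal_position
    {g : ∀ x : M, TangentSpace (𝓡 m) x → TangentSpace (𝓡 m) x → ℝ}
    {B : LinearMap.BilinForm ℝ (Fin N → ℝ)} {Q : Set (Fin N → ℝ)} {f : M → (Fin N → ℝ)}
    (hf : IsIsometricImmersion g B Q f) (hB : ∀ v w, B v w = B w v)
    {c : ℝ} (hQ : ∀ y ∈ Q, B y y = c) (x : M) (v : TangentSpace (𝓡 m) x) :
    B (f x) (ambientDeriv f x v) = 0 := by
  let B' : (Fin N → ℝ) →L[ℝ] (Fin N → ℝ) →L[ℝ] ℝ :=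
    LinearMap.toContinuousLinearMap
      ((LinearMap.toContinuousLinearMap (𝕜 := ℝ) (E := Fin N → ℝ) (F' := ℝ)).toLinearMap ∘ₗ B)
  have hB' : ∀ v w, B' v w = B v w := fun _ _ => rfl
  have hd : MDifferentiableAt (𝓡 m) 𝓘(ℝ, Fin N → ℝ) f x :=
    hf.contMDiff.mdifferentiableAt (by simp)
  have hq : HasFDerivAt (fun y => B' y y) (B' (f x) + B'.flip (f x)) (f x) := by
    have := B'.hasFDerivAt_of_bilinear (hasFDerivAt_id (𝕜 := ℝ) (f x))
      (hasFDerivAt_id (𝕜 := ℝ) (f x))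
    refine this.congr_fderiv ?_
    ext w
    simp
  have h1 := hq.hasMFDerivAt.comp x hd.hasMFDerivAt
  have h2 : HasMFDerivAt (𝓡 m) 𝓘(ℝ, ℝ) (fun _ : M => c) x
      (0 : TangentSpace (𝓡 m) x →L[ℝ] TangentSpace 𝓘(ℝ, ℝ) c) := hasMFDerivAt_const c x
  have he : ((fun y => B' y y) ∘ f) = fun _ => c := by
    funext z
    exact hQ _ (hf.mem z)
  rw [he] at h1
  have h3 := congrArg (fun L => L v) (hasMFDerivAt_unique h1 h2)
  have h4 : B (f x) (ambientDeriv f x v) + B (ambientDeriv f x v) (f x) = 0 := h3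
  rw [hB (ambientDeriv f x v) (f x)] at h4
  linarith

/-- `ℝ^N` is the direct sum of the normal space and of its `B`-orthogonal complement, whenever
the induced metric is positive definite and the position vector is not null. -/
theorem IsIsometricImmersion.isCompl
    {g : ∀ x : M, TangentSpace (𝓡 m) x → TangentSpace (𝓡 m) x → ℝ}
    {B : LinearMap.BilinForm ℝ (Fin N → ℝ)} {Q : Set (Fin N → ℝ)} {f : M → (Fin N → ℝ)}
    (hf : IsIsometricImmersion g B Q f) (hB : ∀ v w, B v w = B w v)
    (hg : ∀ x v, v ≠ 0 → 0 < g x v v) {c : ℝ} (hc : c ≠ 0) (hQ : ∀ y ∈ Q, B y y = c) (x : M) :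
    IsCompl (normalSpace m B f x) (tangentialSpace m f x) := by
  have horth := hf.orthogonal_position hB hQ x
  refine IsCompl.symm ((LinearMap.BilinForm.isCompl_orthogonal_iff_disjoint
    (fun v w h => by rw [hB]; exact h)).2 ?_)
  rw [Submodule.disjoint_def]
  intro y hy hy'
  have hn := (mem_normalSpace_iff (m := m) B f x y).1 hy'
  obtain ⟨a, ha, b, ⟨v, rfl⟩, rfl⟩ := Submodule.mem_sup.1 hy
  obtain ⟨k, rfl⟩ := Submodule.mem_span_singleton.1 ha
  obtain ⟨h1, h2⟩ := hn
  have e : ((ambientDeriv (m := m) f x).toLinearMap v) = ambientDeriv (m := m) f x v := rfl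
  rw [e] at h1 h2 ⊢
  have hk : k = 0 := by
    have := h1
    rw [map_add, map_smul, horth, hQ _ (hf.mem x)] at this
    simpa [hc] using this
  have hv : v = 0 := by
    by_contra hv
    have h3 := h2 v
    rw [map_add, map_smul, hB _ (f x), horth, hf.isometric] at h3
    have := hg x v hv
    simp at h3
    exact this.ne' h3
  simp [hk, hv]

/-- The normal connection `∇^⊥_X ξ`: the normal part of the derivative of `ξ` along `X` in `ℝ^N`.
The Levi-Civita connection of the quadric is the part tangent to the quadric of the
derivative in `ℝ^N`, so this is also the normal part of the covariant derivative of `ξ` along `X`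
in the quadric. -/
def normalConnection (B : LinearMap.BilinForm ℝ (Fin N → ℝ)) (f : M → (Fin N → ℝ))
    (X : ∀ x : M, TangentSpace (𝓡 m) x) (ξ : M → (Fin N → ℝ)) : M → (Fin N → ℝ) :=
  fun x => normalProj m B f x (ambientDeriv ξ x (X x))

/-- `X` is a smooth vector field on `M`. -/
def IsSmoothVectorField (X : ∀ x : M, TangentSpace (𝓡 m) x)
    [IsManifold (𝓡 m) 1 M] : Prop :=
  ContMDiff (𝓡 m) (𝓡 m).tangent ∞ (fun x => (⟨x, X x⟩ : TangentBundle (𝓡 m) M))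

/-- `ξ` is a smooth section of the normal bundle of `f`. -/
def IsSmoothNormalField (m : ℕ) [ChartedSpace (EuclideanSpace ℝ (Fin m)) M]
    (B : LinearMap.BilinForm ℝ (Fin N → ℝ)) (f ξ : M → (Fin N → ℝ)) : Prop :=
  ContMDiff (𝓡 m) 𝓘(ℝ, Fin N → ℝ) ∞ ξ ∧ ∀ x, ξ x ∈ normalSpace m B f x

/-- The normal bundle of `f` is flat: the curvature
`R^⊥(X, Y) ξ = ∇^⊥_X ∇^⊥_Y ξ - ∇^⊥_Y ∇^⊥_X ξ - ∇^⊥_{[X, Y]} ξ` of the normal connection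
vanishes. -/
def HasFlatNormalBundle (m : ℕ) [ChartedSpace (EuclideanSpace ℝ (Fin m)) M]
    [IsManifold (𝓡 m) 1 M]
    (B : LinearMap.BilinForm ℝ (Fin N → ℝ)) (f : M → (Fin N → ℝ)) : Prop :=
  ∀ X Y : ∀ x : M, TangentSpace (𝓡 m) x, IsSmoothVectorField X → IsSmoothVectorField Y →
    ∀ ξ : M → (Fin N → ℝ), IsSmoothNormalField m B f ξ → ∀ x,
      normalConnection B f X (normalConnection B f Y ξ) x
        - normalConnection B f Y (normalConnection B f X ξ) x
        - normalConnection B f (VectorField.mlieBracket (𝓡 m) X Y) ξ x = 0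

end Immersions

end

/-!
The second fundamental form of such an immersion is diagonalized by principal directions, thanks to
the signature of the ambient space and to the small codimension. A principal direction gives a
function without critical points on the sphere minus a point, and compactness of the sphere makes
this impossible.

Let `m ≥ 2`, let `f` be an isometric immersion of `S^m(R)` into the quadric `⟨x, x⟩ = c` and let `φ`
be the inverse of a stereographic projection of the unit sphere. The map `G = (f ∘ φ, R φ)` into the
product of the ambient space with a Euclidean space, with the difference `b` of the two scalar
products, has totally isotropic differential. Hence the products `b (D²G(X, Y)) (D²G(Z, T))` are
symmetric in all four arguments (`bilin_secondDeriv_swap`), which encodes the Gauss equations of `f`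
and of the sphere at once. Let `L` be the image of `DG`, and `K` the orthogonal complement of
`L + ℝG`. The second derivatives take values in `K`, a space of dimension `dim L + m`. If `b` were
not negative on `K ∖ L`, there would be a `b`-nonnegative subspace larger than the index of `b`
allows; this is where `c = -1`, or `R < 1`, is used (`isDiagonalIsotropic_of_signature`). So
Cartan's theorem (`exists_orthonormalBasis_diagonal`) yields at each point an orthonormal basis in
which `D²G` is diagonal modulo `L`, with diagonal entries of negative square.

The principal vectors `Z`, normalized by `b (D²G(Z, Z)) (D²G(Z, Z)) = -|DG(Z)|²`, are the isolated
zeros of a smooth equation, and they stay bounded over compact sets, so that the set of solutions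
is a covering of `ℝ^m`, and a smooth principal field exists globally (`exists_contDiff_section`,
`IsDiagonalIsotropic.exists_principal_field`). By the Codazzi equation (`fderiv_dualForm_symm`) the
form `⟨Z, ·⟩ / |Z|²` is closed, so it is the differential of a function `u` without critical points
(`IsDiagonalIsotropic.exists_potential`). On the compact sphere, `D²G` is bounded in terms of the
metric, and this gives `|du| = O(|y|⁻²)` in the stereographic chart
(`IsDiagonalIsotropic.false_of_inversion`). But such a function has a critical point, because its
oscillation on large spheres tends to zero (`exists_fderiv_eq_zero`).

For `m = 1` the image is a closed curve of positive speed in a conic. On the hyperbola it cannot be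
spacelike where its second coordinate is maximal; on the unit circle its speed `R` has to be an
integer.
-/

noncomputable section

/-! ### Second derivatives of isotropic maps -/

section Calculus

variable {D W : Type*} [NormedAddCommGroup D] [NormedSpace ℝ D]
  [NormedAddCommGroup W] [NormedSpace ℝ W]

/-- The second derivative of `G` at `y`, as a bilinear map. -/
def secondDeriv (G : D → W) (y : D) : D →L[ℝ] D →L[ℝ] W :=
  fderiv ℝ (fderiv ℝ G) y

theorem secondDeriv_comm {G : D → W} (hG : ContDiff ℝ ∞ G) (y X Y : D) :
    secondDeriv G y X Y = secondDeriv G y Y X :=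
  (hG.contDiffAt.isSymmSndFDerivAt
    (by simp; exact WithTop.coe_le_coe.2 (le_top : (2 : ℕ∞) ≤ ⊤))) X Y

theorem contDiff_secondDeriv {G : D → W} (hG : ContDiff ℝ ∞ G) :
    ContDiff ℝ ∞ (secondDeriv G) :=
  (hG.fderiv_right (m := ∞) (by simp)).fderiv_right (m := ∞) (by simp)

theorem contDiff_fderiv_apply {G : D → W} (hG : ContDiff ℝ ∞ G) {Z : D → D}
    (hZ : ContDiff ℝ ∞ Z) : ContDiff ℝ ∞ fun y => fderiv ℝ G y (Z y) :=
  (hG.fderiv_right (m := ∞) (by simp)).clm_apply hZ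

theorem contDiff_secondDeriv_apply {G : D → W} (hG : ContDiff ℝ ∞ G) {Z T : D → D}
    (hZ : ContDiff ℝ ∞ Z) (hT : ContDiff ℝ ∞ T) :
    ContDiff ℝ ∞ fun y => secondDeriv G y (Z y) (T y) :=
  ((contDiff_secondDeriv hG).clm_apply hZ).clm_apply hT

theorem fderiv_fderiv_apply {G : D → W} (hG : ContDiff ℝ ∞ G) {Z : D → D}
    (hZ : ContDiff ℝ ∞ Z) (y X : D) :
    fderiv ℝ (fun y => fderiv ℝ G y (Z y)) y X =
      secondDeriv G y X (Z y) + fderiv ℝ G y (fderiv ℝ Z y X) := by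
  have h1 : DifferentiableAt ℝ (fderiv ℝ G) y :=
    (hG.fderiv_right (m := ∞) (by simp)).differentiable (by simp) y
  have h2 : DifferentiableAt ℝ Z y := hZ.differentiable (by simp) y
  have := (h1.hasFDerivAt.clm_apply h2.hasFDerivAt).fderiv
  rw [this]
  simp [secondDeriv, add_comm]

theorem fderiv_bilin_apply (b : W →L[ℝ] W →L[ℝ] ℝ) {u v : D → W} {y : D}
    (hu : DifferentiableAt ℝ u y) (hv : DifferentiableAt ℝ v y) (X : D) :
    fderiv ℝ (fun y => b (u y) (v y)) y X =
      b (fderiv ℝ u y X) (v y) + b (u y) (fderiv ℝ v y X) := by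
  rw [(b.hasFDerivAt_of_bilinear hu.hasFDerivAt hv.hasFDerivAt).fderiv]
  simp [add_comm]

variable {b : W →L[ℝ] W →L[ℝ] ℝ} {G : D → W}

/-- The second derivative of a map with totally isotropic differential is orthogonal to the image
of the differential. -/
theorem bilin_secondDeriv_fderiv (hG : ContDiff ℝ ∞ G) (hb : ∀ v w, b v w = b w v)
    (hnull : ∀ y X Y, b (fderiv ℝ G y X) (fderiv ℝ G y Y) = 0) (y X Y Z : D) :
    b (secondDeriv G y X Y) (fderiv ℝ G y Z) = 0 := by
  have hd (X : D) : DifferentiableAt ℝ (fun y => fderiv ℝ G y X) y :=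
    (contDiff_fderiv_apply hG contDiff_const).differentiable (by simp) y
  have key (X Y Z : D) : b (secondDeriv G y Z X) (fderiv ℝ G y Y)
      + b (secondDeriv G y Z Y) (fderiv ℝ G y X) = 0 := by
    have h := fderiv_bilin_apply b (hd X) (hd Y) Z
    simp only [hnull, fderiv_fun_const, fderiv_fderiv_apply hG contDiff_const] at h
    simp only [Pi.zero_apply, zero_apply, map_zero, add_zero] at h
    rw [h, hb (fderiv ℝ G y X)]
  have h1 := key X Y Z
  have h2 := key Y Z X
  have h3 := key Z X Y
  rw [secondDeriv_comm hG y Z X, secondDeriv_comm hG y Z Y] at h1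
  rw [secondDeriv_comm hG y Y X] at h3
  linarith

/-- The Gauss equation: for a map with totally isotropic differential the scalar products of the
second derivatives are symmetric in all four arguments. -/
theorem bilin_secondDeriv_swap (hG : ContDiff ℝ ∞ G) (hb : ∀ v w, b v w = b w v)
    (hnull : ∀ y X Y, b (fderiv ℝ G y X) (fderiv ℝ G y Y) = 0) (y X Y Z T : D) :
    b (secondDeriv G y X Y) (secondDeriv G y Z T)
      = b (secondDeriv G y Z Y) (secondDeriv G y X T) := by
  have hd : DifferentiableAt ℝ (fun y => fderiv ℝ G y T) y :=
    (contDiff_fderiv_apply hG contDiff_const).differentiable (by simp) y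
  have hdd (X : D) : DifferentiableAt ℝ (fun y => secondDeriv G y X Y) y :=
    (contDiff_secondDeriv_apply hG contDiff_const contDiff_const).differentiable (by simp) y
  have hGY : ContDiff ℝ ∞ fun y => fderiv ℝ G y Y := contDiff_fderiv_apply hG contDiff_const
  have key (X Z : D) : b (fderiv ℝ (fun y => secondDeriv G y X Y) y Z) (fderiv ℝ G y T)
      + b (secondDeriv G y X Y) (secondDeriv G y Z T) = 0 := by
    have h := fderiv_bilin_apply b (hdd X) hd Z
    simp only [bilin_secondDeriv_fderiv hG hb hnull, fderiv_fun_const,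
      fderiv_fderiv_apply hG contDiff_const] at h
    simp only [Pi.zero_apply, zero_apply, map_zero, add_zero] at h
    exact h.symm
  have hsymm : fderiv ℝ (fun y => secondDeriv G y X Y) y Z
      = fderiv ℝ (fun y => secondDeriv G y Z Y) y X := by
    have e (X Z : D) : fderiv ℝ (fun y => secondDeriv G y X Y) y Z
        = secondDeriv (fun y => fderiv ℝ G y Y) y Z X := by
      have : (fun y => secondDeriv G y X Y)
          = fun y => fderiv ℝ (fun y => fderiv ℝ G y Y) y X := by
        funext z
        rw [fderiv_fderiv_apply hG contDiff_const]
        simp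
      rw [this, fderiv_fderiv_apply hGY contDiff_const]
      simp
    rw [e, e, secondDeriv_comm hGY]
  have h1 := key X Z
  have h2 := key Z X
  rw [hsymm] at h1
  linarith

/-- Let `Z` be a principal vector field, normalized by `|G''(Z, Z)|² = -|Z|²` (for the metric `h`
pulled back by `G` on the right-hand side). The `1`-form dual to `Z` is closed. This is the
Codazzi equation: the second derivatives of `G'(Z)` commute, and their product with `G''(Z, Z)` is
the exterior derivative of the form, up to a factor. -/
theorem fderiv_dualForm_symm (hG : ContDiff ℝ ∞ G) (hb : ∀ v w, b v w = b w v)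
    (hnull : ∀ y X Y, b (fderiv ℝ G y X) (fderiv ℝ G y Y) = 0)
    {h : W →L[ℝ] W →L[ℝ] ℝ} (hh : ∀ v w, h v w = h w v)
    {Z : D → D} (hZ : ContDiff ℝ ∞ Z) {p : D → ℝ} {θ : D → D →L[ℝ] ℝ}
    (hp : ∀ y, p y = h (fderiv ℝ G y (Z y)) (fderiv ℝ G y (Z y))) (hp0 : ∀ y, p y ≠ 0)
    (hθ : Differentiable ℝ θ)
    (hpθ : ∀ y X, p y * θ y X = h (fderiv ℝ G y (Z y)) (fderiv ℝ G y X))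
    (hq : ∀ y, b (secondDeriv G y (Z y) (Z y)) (secondDeriv G y (Z y) (Z y)) = - p y)
    (hL : ∀ y X, ∃ s, secondDeriv G y X (Z y) - θ y X • secondDeriv G y (Z y) (Z y)
      = fderiv ℝ G y s) (y X Y : D) :
    fderiv ℝ θ y X Y = fderiv ℝ θ y Y X := by
  set E : D → W := fun y => fderiv ℝ G y (Z y) with hE
  set ζ : D → W := fun y => secondDeriv G y (Z y) (Z y) with hζ
  have cE : ContDiff ℝ ∞ E := contDiff_fderiv_apply hG hZ
  have cζ : ContDiff ℝ ∞ ζ := contDiff_secondDeriv_apply hG hZ hZ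
  have dE : Differentiable ℝ E := cE.differentiable (by simp)
  have dζ : Differentiable ℝ ζ := cζ.differentiable (by simp)
  have hDE (X : D) : Differentiable ℝ (fun y => fderiv ℝ E y X) :=
    (contDiff_fderiv_apply cE contDiff_const).differentiable (by simp)
  have dp : Differentiable ℝ p := by
    have : p = fun y => h (E y) (E y) := funext hp
    rw [this]
    intro y
    exact (h.hasFDerivAt_of_bilinear (dE y).hasFDerivAt (dE y).hasFDerivAt).differentiableAt
  have hLζ (y v : D) : b (fderiv ℝ G y v) (ζ y) = 0 := by
    rw [hb]; exact bilin_secondDeriv_fderiv hG hb hnull _ _ _ _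
  -- the derivative of `E` is `θ • ζ` modulo the image of the differential of `G`
  have hs (y X : D) : ∃ s, fderiv ℝ E y X = θ y X • ζ y + fderiv ℝ G y s := by
    obtain ⟨s, hs⟩ := hL y X
    refine ⟨s + fderiv ℝ Z y X, ?_⟩
    rw [hE, fderiv_fderiv_apply hG hZ, map_add, ← hs]
    simp only [hζ]
    abel
  have hA (y X : D) : b (fderiv ℝ E y X) (ζ y) = - (p y * θ y X) := by
    obtain ⟨s, hs⟩ := hs y X
    rw [hs, map_add, map_smul, add_apply, hLζ,
      smul_apply]
    simp only [hζ, hq, smul_eq_mul]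
    ring
  have hA' (X Y : D) : b (secondDeriv E y Y X) (ζ y) + b (fderiv ℝ E y X) (fderiv ℝ ζ y Y)
      = - (fderiv ℝ p y Y * θ y X + p y * fderiv ℝ θ y Y X) := by
    have h1 := fderiv_bilin_apply b (hDE X y) (dζ y) Y
    rw [fderiv_fderiv_apply cE contDiff_const] at h1
    simp only [hA] at h1
    have h2 : HasFDerivAt (fun y => θ y X)
        ((ContinuousLinearMap.apply ℝ ℝ X).comp (fderiv ℝ θ y)) y :=
      (ContinuousLinearMap.apply ℝ ℝ X).hasFDerivAt.comp y (hθ y).hasFDerivAt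
    have h3 := ((dp y).hasFDerivAt.mul h2).neg.fderiv
    have h4 : (fun y => -(p y * θ y X)) = -(p * fun y => θ y X) := by funext; simp
    rw [h4, h3] at h1
    simp at h1
    linarith
  have hB (Y : D) : 2 * b (ζ y) (fderiv ℝ ζ y Y) = - fderiv ℝ p y Y := by
    have h1 := fderiv_bilin_apply b (dζ y) (dζ y) Y
    have h2 : (fun y => b (ζ y) (ζ y)) = fun y => - p y := funext hq
    rw [h2, fderiv_fun_neg, hb (fderiv ℝ ζ y Y)] at h1
    simp at h1
    linarith
  have hmix (Y v : D) : b (secondDeriv G y Y v) (ζ y) = - (p y * θ y Y * θ y v) := by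
    rw [secondDeriv_comm hG y Y v, hζ, hb, bilin_secondDeriv_swap hG hb hnull,
      secondDeriv_comm hG y (Z y) Y]
    obtain ⟨s, hs⟩ := hL y Y
    obtain ⟨t, ht⟩ := hL y v
    rw [sub_eq_iff_eq_add] at hs ht
    rw [hs, ht]
    simp only [map_add, map_smul, add_apply, smul_apply,
      hnull, hq, bilin_secondDeriv_fderiv hG hb hnull, smul_eq_mul]
    have := hLζ y t
    simp only [hζ] at this
    rw [this]
    ring
  have hC (X : D) : 2 * h (E y) (fderiv ℝ E y X) = fderiv ℝ p y X := by
    have h1 := fderiv_bilin_apply h (dE y) (dE y) X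
    have h2 : (fun y => h (E y) (E y)) = p := (funext hp).symm
    rw [h2, hh (fderiv ℝ E y X)] at h1
    linarith
  have hD (X Y : D) : b (fderiv ℝ E y X) (fderiv ℝ ζ y Y) = - (θ y X * fderiv ℝ p y Y) / 2
      + θ y Y * fderiv ℝ p y X / 2 - θ y X * θ y Y * h (E y) (ζ y) := by
    obtain ⟨s, hs⟩ := hs y X
    have h1 : b (secondDeriv G y Y s) (ζ y) + b (fderiv ℝ G y s) (fderiv ℝ ζ y Y) = 0 := by
      have hd : DifferentiableAt ℝ (fun y => fderiv ℝ G y s) y :=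
        (contDiff_fderiv_apply hG contDiff_const).differentiable (by simp) y
      have h1 := fderiv_bilin_apply b hd (dζ y) Y
      simp only [hLζ, fderiv_fun_const, fderiv_fderiv_apply hG contDiff_const] at h1
      simp only [Pi.zero_apply, zero_apply, map_zero, add_zero] at h1
      exact h1.symm
    rw [hmix] at h1
    have h2 := hpθ y s
    have h3 : fderiv ℝ G y s = fderiv ℝ E y X - θ y X • ζ y := by rw [hs]; abel
    have h4 := hC X
    have h5 := hB Y
    have h6 : b (fderiv ℝ E y X) (fderiv ℝ ζ y Y)
        = θ y X * b (ζ y) (fderiv ℝ ζ y Y) + b (fderiv ℝ G y s) (fderiv ℝ ζ y Y) := by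
      rw [hs]; simp
    have h7 : h (fderiv ℝ G y (Z y)) (fderiv ℝ G y s)
        = h (E y) (fderiv ℝ E y X) - θ y X * h (E y) (ζ y) := by
      rw [h3]; simp [hE]
    rw [h7] at h2
    rw [h6]
    linear_combination h1 + θ y Y * h2 + θ y Y / 2 * h4 + θ y X / 2 * h5
  have h1 := hA' X Y
  have h2 := hA' Y X
  rw [secondDeriv_comm cE y Y X] at h1
  have h3 := hD X Y
  have h4 := hD Y X
  have : p y * (fderiv ℝ θ y X Y - fderiv ℝ θ y Y X) = 0 := by
    linear_combination h2 - h1 + h3 - h4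
  exact sub_eq_zero.1 ((mul_eq_zero.1 this).resolve_left (hp0 y))

end Calculus

/-! ### Cartan's theorem on exteriorly orthogonal forms -/

section Cartan

open Module Module.End

variable {D E : Type*} [NormedAddCommGroup D] [InnerProductSpace ℝ D] [FiniteDimensional ℝ D]

/-- A minimum of `‖β X X‖` on the unit sphere is a regular element of `β`: if `β X n = 0`, then
moving `X` in the direction of `n` leaves `‖β X X‖` unchanged up to fourth order, while the norm
of `X` grows to second order. -/
theorem exists_regular_element [NormedAddCommGroup E] [InnerProductSpace ℝ E]
    [FiniteDimensional ℝ E] (β : D →ₗ[ℝ] D →ₗ[ℝ] E) (hβ : ∀ X Y, β X Y = β Y X)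
    (hs : ∀ X Y Z T, inner ℝ (β X Y) (β Z T) = inner ℝ (β Z Y) (β X T))
    (h0 : ∀ X, β X X = 0 → X = 0) : ∃ X, ∀ n, β X n = 0 → n = 0 := by
  rcases subsingleton_or_nontrivial D with hD | hD
  · exact ⟨0, fun n _ => Subsingleton.elim _ _⟩
  have hc : Continuous fun X => ‖β X X‖ ^ 2 := by
    let β' : D →ₗ[ℝ] D →L[ℝ] E := LinearMap.toContinuousLinearMap.toLinearMap ∘ₗ β
    have h1 : Continuous β' := β'.continuous_of_finiteDimensional
    have h2 : Continuous fun X => β' X X := h1.clm_apply continuous_id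
    exact (h2.norm).pow 2
  obtain ⟨X, hX, hmin⟩ := (isCompact_sphere (0 : D) 1).exists_isMinOn
    (NormedSpace.sphere_nonempty.2 zero_le_one) hc.continuousOn
  have hX1 : ‖X‖ = 1 := by simpa using hX
  have hmin' (Y : D) : ‖β X X‖ ^ 2 * ‖Y‖ ^ 4 ≤ ‖β Y Y‖ ^ 2 := by
    rcases eq_or_ne Y 0 with rfl | hY
    · simp
    have hn : 0 < ‖Y‖ := norm_pos_iff.2 hY
    have h1 : ‖Y‖⁻¹ • Y ∈ Metric.sphere (0 : D) 1 := by
      simp [norm_smul, hn.ne']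
    have h2 := isMinOn_iff.1 hmin _ h1
    simp only [map_smul, LinearMap.smul_apply, smul_smul, norm_smul, mul_pow] at h2
    have h3 : ‖‖Y‖⁻¹ * ‖Y‖⁻¹‖ ^ 2 = (‖Y‖ ^ 4)⁻¹ := by
      rw [Real.norm_of_nonneg (by positivity)]
      field_simp
    rw [h3] at h2
    calc _ ≤ (‖Y‖ ^ 4)⁻¹ * ‖β Y Y‖ ^ 2 * ‖Y‖ ^ 4 := by gcongr
      _ = _ := by field_simp
  have hF : 0 < ‖β X X‖ ^ 2 := by
    have : β X X ≠ 0 := fun h => by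
      have := h0 X h
      rw [this] at hX1
      simp at hX1
    positivity
  have key (n : D) (hn : β X n = 0) (hXn : 0 ≤ inner ℝ X n) : n = 0 := by
    have hcross : inner ℝ (β X X) (β n n) = 0 := by
      rw [hs, hβ n X, hn, inner_zero_left]
    set F := ‖β X X‖ ^ 2
    set N := ‖β n n‖ ^ 2 with hN
    have hN0 : 0 ≤ N := by positivity
    have h1 (t : ℝ) (ht : 0 ≤ t) : F * (1 + 2 * (t ^ 2 * ‖n‖ ^ 2)) ≤ F + t ^ 4 * N := by
      have e1 : ‖β (X + t • n) (X + t • n)‖ ^ 2 = F + t ^ 4 * N := by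
        have : β (X + t • n) (X + t • n) = β X X + (t ^ 2) • β n n := by
          simp [hβ n X, hn, smul_smul, sq]
        rw [this, norm_add_sq_real, inner_smul_right, hcross, norm_smul, mul_pow]
        simp only [mul_zero, add_zero, norm_pow, Real.norm_eq_abs, sq_abs, F, N]
        ring
      have e2 : 1 + t ^ 2 * ‖n‖ ^ 2 ≤ ‖X + t • n‖ ^ 2 := by
        rw [norm_add_sq_real, inner_smul_right, norm_smul, mul_pow, hX1]
        have : 0 ≤ t * inner ℝ X n := mul_nonneg ht hXn
        simp
        linarith
      have e3 : 1 + 2 * (t ^ 2 * ‖n‖ ^ 2) ≤ ‖X + t • n‖ ^ 4 := by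
        have e4 : ‖X + t • n‖ ^ 4 = (‖X + t • n‖ ^ 2) ^ 2 := by ring
        have e5 : 0 ≤ t ^ 2 * ‖n‖ ^ 2 := by positivity
        rw [e4]
        nlinarith
      calc _ ≤ F * ‖X + t • n‖ ^ 4 := by gcongr
        _ ≤ _ := hmin' _
        _ = _ := e1
    by_contra hne
    have hn0 : 0 < ‖n‖ ^ 2 := by have := norm_pos_iff.2 hne; positivity
    -- the inequality fails for small `t`
    have h2 := h1 (Real.sqrt (‖n‖ ^ 2 * F / (N + 1))) (Real.sqrt_nonneg _)
    have e4 : Real.sqrt (‖n‖ ^ 2 * F / (N + 1)) ^ 2 = ‖n‖ ^ 2 * F / (N + 1) :=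
      Real.sq_sqrt (by positivity)
    have e5 : Real.sqrt (‖n‖ ^ 2 * F / (N + 1)) ^ 4 = (‖n‖ ^ 2 * F / (N + 1)) ^ 2 :=
      calc _ = (Real.sqrt (‖n‖ ^ 2 * F / (N + 1)) ^ 2) ^ 2 := by ring
        _ = _ := by rw [e4]
    rw [e5, e4] at h2
    set a := ‖n‖ ^ 2 * F / (N + 1) with ha
    have hapos : 0 < a := by positivity
    have haN : a * (N + 1) = ‖n‖ ^ 2 * F := by rw [ha]; field_simp
    have h3 : 2 * a * (‖n‖ ^ 2 * F) ≤ a * (a * N) := by nlinarith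
    have h4 : 2 * (‖n‖ ^ 2 * F) ≤ a * N := by
      have : a * (2 * (‖n‖ ^ 2 * F)) ≤ a * (a * N) := by linarith
      exact le_of_mul_le_mul_left this hapos
    nlinarith
  refine ⟨X, fun n hn => ?_⟩
  rcases le_total 0 (inner ℝ X n) with h | h
  · exact key n hn h
  · refine neg_eq_zero.1 (key (-n) (by simp [hn]) ?_)
    rw [inner_neg_right]
    linarith

/-- Cartan's theorem, for a Euclidean target: for a regular element `X` the operators
`β Y ∘ (β X)⁻¹` are symmetric and commute, and a joint eigenbasis diagonalizes `β`. -/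
theorem exists_basis_diagonal_of_inner [NormedAddCommGroup E] [InnerProductSpace ℝ E]
    [FiniteDimensional ℝ E] (β : D →ₗ[ℝ] D →ₗ[ℝ] E) (hβ : ∀ X Y, β X Y = β Y X)
    (hs : ∀ X Y Z T, inner ℝ (β X Y) (β Z T) = inner ℝ (β Z Y) (β X T))
    (h0 : ∀ X, β X X = 0 → X = 0) (hdim : finrank ℝ E ≤ finrank ℝ D) :
    ∃ e : Basis (Fin (finrank ℝ D)) ℝ D, ∀ a c, a ≠ c → β (e a) (e c) = 0 := by
  classical
  obtain ⟨X, hX⟩ := exists_regular_element β hβ hs h0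
  have hinj : Function.Injective (β X) := (injective_iff_map_eq_zero (β X)).2 hX
  have hdim' : finrank ℝ D = finrank ℝ E :=
    le_antisymm (LinearMap.finrank_le_finrank_of_injective hinj) hdim
  let Φ : D ≃ₗ[ℝ] E := LinearEquiv.ofInjectiveOfFinrankEq (β X) hinj hdim'
  have hΦ (Y : D) : Φ Y = β X Y := rfl
  let T : D → E →ₗ[ℝ] E := fun Y => β Y ∘ₗ Φ.symm.toLinearMap
  have hT (Y Z : D) : T Y (β X Z) = β Y Z := by
    change β Y (Φ.symm (Φ Z)) = _
    simp
  have hsurj (w : E) : ∃ Z, β X Z = w := ⟨Φ.symm w, by rw [← hΦ]; simp⟩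
  have hTsymm (Y : D) : (T Y).IsSymmetric := by
    intro v w
    obtain ⟨Z, rfl⟩ := hsurj v
    obtain ⟨Z', rfl⟩ := hsurj w
    rw [hT, hT, hs, real_inner_comm]
  have hcomm : Pairwise (Function.onFun Commute T) := by
    intro Y Y' _
    refine LinearMap.ext fun v => ?_
    refine ext_inner_right ℝ fun w => ?_
    obtain ⟨Z, rfl⟩ := hsurj v
    obtain ⟨Z', rfl⟩ := hsurj w
    rw [Module.End.mul_apply, Module.End.mul_apply, hTsymm Y (T Y' _), hTsymm Y' (T Y _),
      hT, hT, hT, hT, hs]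
  have hint := LinearMap.IsSymmetric.directSum_isInternal_of_pairwise_commute hTsymm hcomm
  let ε := hint.collectedBasis fun χ : D → ℝ =>
    finBasis ℝ (⨅ Y, eigenspace (T Y) (χ Y) : Submodule ℝ E)
  have hε (i) (Y : D) : T Y (ε i) = i.1 Y • ε i := by
    have := hint.collectedBasis_mem (fun χ : D → ℝ =>
      finBasis ℝ (⨅ Y, eigenspace (T Y) (χ Y) : Submodule ℝ E)) i
    exact mem_eigenspace_iff.1 ((Submodule.mem_iInf _).1 this Y)
  have : Fintype (Σ χ : D → ℝ, Fin (finrank ℝ (⨅ Y, eigenspace (T Y) (χ Y) : Submodule ℝ E))) :=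
    FiniteDimensional.fintypeBasisIndex ε
  have hcard : Fintype.card _ = finrank ℝ D := (finrank_eq_card_basis ε).symm.trans hdim'.symm
  let e' := ε.map Φ.symm
  have he' (i j) (hij : i ≠ j) : β (e' i) (e' j) = 0 := by
    have h1 (i) : β X (e' i) = ε i := by
      rw [← hΦ]; simp [e']
    have h2 (i j) : β (e' i) (e' j) = j.1 (e' i) • ε j := by
      rw [← hε j (e' i), ← h1 j, hT]
    have h3 : j.1 (e' i) • ε j = i.1 (e' j) • ε i := by
      rw [← h2, ← h2, hβ]
    rw [h2]
    have h4 := congrArg (fun v => ε.repr v j) h3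
    simp [hij] at h4
    simp [h4]
  refine ⟨e'.reindex (Fintype.equivFinOfCardEq hcard), fun a c hac => ?_⟩
  simp only [Basis.reindex_apply]
  exact he' _ _ fun h => hac ((Equiv.injective _) h)

/-- **Cartan's theorem on exteriorly orthogonal forms.** Let `β` be a symmetric bilinear map into a
space of at most the same dimension, with a definite scalar product for which `s (β X Y) (β Z T)` is
symmetric in all arguments. If `β X X ≠ 0` for `X ≠ 0`, then `β` is diagonal in some basis. -/
theorem exists_basis_diagonal [AddCommGroup E] [Module ℝ E] [FiniteDimensional ℝ E]
    (s : LinearMap.BilinForm ℝ E) (hsymm : ∀ v w, s v w = s w v)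
    (hpos : ∀ v, v ≠ 0 → 0 < s v v) (β : D →ₗ[ℝ] D →ₗ[ℝ] E) (hβ : ∀ X Y, β X Y = β Y X)
    (hs : ∀ X Y Z T, s (β X Y) (β Z T) = s (β Z Y) (β X T))
    (h0 : ∀ X, β X X = 0 → X = 0) (hdim : finrank ℝ E ≤ finrank ℝ D) :
    ∃ e : Basis (Fin (finrank ℝ D)) ℝ D, ∀ a c, a ≠ c → β (e a) (e c) = 0 := by
  let core : InnerProductSpace.Core ℝ E :=
    { inner := fun v w => s v w
      conj_inner_symm := fun v w => hsymm _ _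
      re_inner_nonneg := fun v => by
        rcases eq_or_ne v 0 with rfl | hv
        · simp
        · exact (hpos v hv).le
      add_left := fun u v w => by simp
      smul_left := fun u v r => by simp
      definite := fun v hv => by
        by_contra hne
        exact (hpos v hne).ne' hv }
  let : NormedAddCommGroup E := core.toNormedAddCommGroup
  let : InnerProductSpace ℝ E := InnerProductSpace.ofCore core.toCore
  exact exists_basis_diagonal_of_inner β hβ hs h0 hdim

end Cartan

/-! ### Sections of the zero set of a nondegenerate equation -/

section ZeroSet

open Topology Filter

variable {D E F : Type*} [NormedAddCommGroup D] [NormedSpace ℝ D] [FiniteDimensional ℝ D]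
  [NormedAddCommGroup E] [NormedSpace ℝ E] [FiniteDimensional ℝ E]
  [NormedAddCommGroup F] [NormedSpace ℝ F] [CompleteSpace F]

/-- By the implicit function theorem the zero set of an equation that is nondegenerate in the
second variable is étale over the first factor. -/
theorem isLocalHomeomorph_fst_zeroSet {Ψ : D × E → F} (hΨ : ContDiff ℝ ∞ Ψ)
    (hinv : ∀ u, Ψ u = 0 → (fderiv ℝ Ψ u ∘L .inr ℝ D E).IsInvertible) :
    IsLocalHomeomorph (fun u : {u : D × E // Ψ u = 0} => u.1.1) := by
  classical
  have : CompleteSpace D := FiniteDimensional.complete ℝ D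
  have : CompleteSpace E := FiniteDimensional.complete ℝ E
  intro u
  have cd : ContDiffAt ℝ ∞ Ψ u.1 := hΨ.contDiffAt
  set φ := cd.implicitFunction (by simp) (hinv u.1 u.2) with hφ
  have h1 := cd.eventually_apply_eq_iff_implicitFunction (by simp) (hinv u.1 u.2)
  have h0 : φ u.1.1 = u.1.2 := cd.implicitFunction_apply_self (by simp) (hinv u.1 u.2)
  have hc : ContDiffAt ℝ ∞ φ u.1.1 := cd.contDiffAt_implicitFunction (by simp) (hinv u.1 u.2)
  rw [← hφ, u.2] at h1
  obtain ⟨N, hN, hNo, huN⟩ := eventually_nhds_iff.1 h1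
  have h2 : ∀ᶠ x in 𝓝 u.1.1, ContinuousAt φ x :=
    ((hc.of_le (m := 1) (by simp)).eventually (by simp)).mono fun x hx => hx.continuousAt
  have h3 : ∀ᶠ x in 𝓝 u.1.1, (x, φ x) ∈ N := by
    have : ContinuousAt (fun x => (x, φ x)) u.1.1 := continuousAt_id.prodMk hc.continuousAt
    refine this.eventually (hNo.mem_nhds ?_)
    change (u.1.1, φ u.1.1) ∈ N
    rw [h0]
    exact huN
  obtain ⟨U, hU, hUo, huU⟩ := eventually_nhds_iff.1 (h2.and h3)
  have hz (x : D) (hx : x ∈ U) : Ψ (x, φ x) = 0 := (hN _ (hU x hx).2).2 rfl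
  refine ⟨{ toFun := fun v => v.1.1
            invFun := fun x => if hx : x ∈ U then ⟨(x, φ x), hz x hx⟩ else u
            source := {v | v.1 ∈ N ∧ v.1.1 ∈ U}
            target := U
            map_source' := fun v hv => hv.2
            map_target' := fun x hx => by
              simp only [hx, dif_pos]
              exact ⟨(hU x hx).2, hx⟩
            left_inv' := fun v hv => by
              simp only [hv.2, dif_pos]
              exact Subtype.ext (Prod.ext rfl ((hN _ hv.1).1 v.2))
            right_inv' := fun x hx => by simp only [hx, dif_pos]
            open_source := (hNo.preimage continuous_subtype_val).inter
              (hUo.preimage (continuous_fst.comp continuous_subtype_val))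
            open_target := hUo
            continuousOn_toFun := (continuous_fst.comp continuous_subtype_val).continuousOn
            continuousOn_invFun := ?_ }, ⟨huN, huU⟩, rfl⟩
  rw [(IsInducing.induced (Subtype.val : {u : D × E // Ψ u = 0} → D × E)).continuousOn_iff]
  have : ContinuousOn (fun x => (x, φ x)) U :=
    continuousOn_id.prodMk fun x hx => (hU x hx).1.continuousWithinAt
  refine this.congr fun x hx => ?_
  simp [hx]

/-- If moreover the zeros are locally bounded, then the zero set is a covering of the first factor,
so that through each zero there passes a global section. -/
theorem exists_contDiff_section {Ψ : D × E → F} (hΨ : ContDiff ℝ ∞ Ψ)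
    (hinv : ∀ u, Ψ u = 0 → (fderiv ℝ Ψ u ∘L .inr ℝ D E).IsInvertible)
    (hbdd : ∀ K : Set D, IsCompact K → ∃ C, ∀ y ∈ K, ∀ Z, Ψ (y, Z) = 0 → ‖Z‖ ≤ C)
    (u₀ : D × E) (hu₀ : Ψ u₀ = 0) :
    ∃ Z : D → E, ContDiff ℝ ∞ Z ∧ Z u₀.1 = u₀.2 ∧ ∀ y, Ψ (y, Z y) = 0 := by
  have : CompleteSpace D := FiniteDimensional.complete ℝ D
  have : CompleteSpace E := FiniteDimensional.complete ℝ E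
  have : ProperSpace D := FiniteDimensional.proper ℝ D
  have : ProperSpace E := FiniteDimensional.proper ℝ E
  set p : {u : D × E // Ψ u = 0} → D := fun u => u.1.1 with hp
  have hpc : Continuous p := continuous_fst.comp continuous_subtype_val
  have hlh : IsLocalHomeomorph p := isLocalHomeomorph_fst_zeroSet hΨ hinv
  have hproper : IsProperMap p := by
    refine isProperMap_iff_isCompact_preimage.2 ⟨hpc, fun K hK => ?_⟩
    obtain ⟨C, hC⟩ := hbdd K hK
    rw [Subtype.isCompact_iff]
    have himg : Subtype.val '' (p ⁻¹' K) =
        (K ×ˢ Metric.closedBall (0 : E) C) ∩ {u | Ψ u = 0} := by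
      ext ⟨y, Z⟩
      constructor
      · rintro ⟨⟨⟨y', Z'⟩, h0⟩, hK', h⟩
        obtain ⟨rfl, rfl⟩ := Prod.ext_iff.1 h
        exact ⟨⟨hK', by simpa using hC _ hK' _ h0⟩, h0⟩
      · rintro ⟨⟨h1, h2⟩, h3⟩
        exact ⟨⟨(y, Z), h3⟩, h1, rfl⟩
    rw [himg]
    exact (hK.prod (isCompact_closedBall _ _)).inter_right
      (isClosed_singleton.preimage hΨ.continuous)
  have hfin (x : D) : (p ⁻¹' {x}).Finite := by
    refine (hproper.isCompact_preimage isCompact_singleton).finite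
      (IsDiscrete.of_openPartialHomeomorph p subset_rfl fun e _ => ?_)
    obtain ⟨φ, hφ, h⟩ := hlh e
    exact ⟨φ, hφ, h.symm⟩
  have hcov : IsCoveringMap p := by
    rw [isCoveringMap_iff_isCoveringMapOn_univ]
    exact hproper.isClosedMap.isCoveringMapOn_of_isLocalHomeomorphOn (fun x _ => hfin x)
      (by simpa [← isLocalHomeomorph_iff_isLocalHomeomorphOn_univ])
  obtain ⟨S, ⟨hS0, hS⟩, -⟩ := hcov.existsUnique_continuousMap_lifts (ContinuousMap.id D)
    u₀.1 ⟨u₀, hu₀⟩ rfl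
  have hS1 (y : D) : (S y).1.1 = y := congrFun hS y
  have hSe (y : D) : (S y).1 = (y, (S y).1.2) := Prod.ext (hS1 y) rfl
  refine ⟨fun y => (S y).1.2, contDiff_iff_contDiffAt.2 fun y => ?_, by simp [hS0],
    fun y => by rw [← hSe]; exact (S y).2⟩
  have cd : ContDiffAt ℝ ∞ Ψ (S y).1 := hΨ.contDiffAt
  have h1 := cd.eventually_apply_eq_iff_implicitFunction (by simp) (hinv _ (S y).2)
  have hc := cd.contDiffAt_implicitFunction (by simp) (hinv _ (S y).2)
  rw [hS1] at hc
  refine hc.congr_of_eventuallyEq ?_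
  have hcont : ContinuousAt (fun z => (S z).1) y :=
    (continuous_subtype_val.comp S.continuous).continuousAt
  filter_upwards [hcont.eventually h1] with z hz
  have := hz.1 ((S z).2.trans (S y).2.symm)
  rw [hS1] at this
  exact this.symm

end ZeroSet

/-! ### Principal directions -/

section Principal

open Module

variable {m : ℕ} {W : Type*} [NormedAddCommGroup W] [NormedSpace ℝ W] [FiniteDimensional ℝ W]

local notation "D" => EuclideanSpace ℝ (Fin m)

/-- Cartan's theorem for a bilinear map `A` with values in a subspace `K` on which `b` is negative
semidefinite with radical `L`: modulo `L`, the map `A` is diagonal in an orthonormal basis. The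
vector `ν` recovers the Euclidean scalar product from `A`, which makes the basis orthogonal. -/
theorem exists_orthonormalBasis_diagonal {b : W →L[ℝ] W →L[ℝ] ℝ} (hb : ∀ v w, b v w = b w v)
    {A : D →L[ℝ] D →L[ℝ] W} (hA : ∀ X Y, A X Y = A Y X)
    (hs : ∀ X Y Z T, b (A X Y) (A Z T) = b (A Z Y) (A X T))
    {L K : Submodule ℝ W} (hLK : L ≤ K) (hLnull : ∀ l ∈ L, ∀ k ∈ K, b l k = 0)
    (hneg : ∀ k ∈ K, k ∉ L → b k k < 0) (hdim : finrank ℝ K ≤ finrank ℝ L + m)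
    (hAK : ∀ X Y, A X Y ∈ K) {ν : W} {σ : ℝ} (hσ : 0 < σ)
    (hν : ∀ X Y, b (A X Y) ν = σ * inner ℝ X Y) (hLν : ∀ l ∈ L, b l ν = 0) :
    ∃ e : OrthonormalBasis (Fin m) ℝ D,
      (∀ a c, a ≠ c → A (e a) (e c) ∈ L) ∧ ∀ a, b (A (e a) (e a)) (A (e a) (e a)) < 0 := by
  have h0 (X : D) (hX : A X X ∈ L) : X = 0 := by
    have h1 := hν X X
    rw [hLν _ hX, real_inner_self_eq_norm_sq] at h1
    simpa [hσ.ne'] using h1.symm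
  set L' : Submodule ℝ K := L.comap K.subtype with hL'
  obtain ⟨M, hM⟩ := L'.exists_isCompl
  let pr : K →ₗ[ℝ] M := M.projectionOnto L' hM.symm
  have hpr (k : K) : k - (pr k : K) ∈ L' := by
    have : pr (k - (pr k : K)) = 0 := by
      rw [map_sub, sub_eq_zero]
      exact (Submodule.projectionOnto_apply_left hM.symm (pr k)).symm
    exact (Submodule.projectionOnto_apply_eq_zero_iff hM.symm).1 this
  let β : D →ₗ[ℝ] D →ₗ[ℝ] M := LinearMap.mk₂ ℝ (fun X Y => pr ⟨A X Y, hAK X Y⟩)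
    (fun X X' Y => by rw [← map_add]; congr 1; ext; simp)
    (fun c X Y => by rw [← map_smul]; congr 1; ext; simp)
    (fun X Y Y' => by rw [← map_add]; congr 1; ext; simp)
    (fun c X Y => by rw [← map_smul]; congr 1; ext; simp)
  have hβ0 (X Y : D) (h : β X Y = 0) : A X Y ∈ L := by
    have := hpr ⟨A X Y, hAK X Y⟩
    change pr _ = 0 at h
    rw [h] at this
    simpa [hL'] using this
  let s : LinearMap.BilinForm ℝ M := LinearMap.mk₂ ℝ (fun v w => - b (v : W) (w : W))
    (fun u v w => by simp; ring) (fun c v w => by simp) (fun u v w => by simp; ring)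
    (fun c v w => by simp)
  have hsβ (X Y Z T : D) : s (β X Y) (β Z T) = - b (A X Y) (A Z T) := by
    have e1 (X Y : D) : ∃ l ∈ L, A X Y = ((β X Y : K) : W) + l :=
      ⟨_, hpr ⟨A X Y, hAK X Y⟩, by simp [β]⟩
    obtain ⟨l, hl, e⟩ := e1 X Y
    obtain ⟨l', hl', e'⟩ := e1 Z T
    change - b ((β X Y : K) : W) ((β Z T : K) : W) = _
    rw [e, e']
    simp [hLnull l hl _ (β Z T : K).2, hLnull l hl l' (hLK hl'),
      (hb _ l').trans (hLnull l' hl' _ (β X Y : K).2)]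
  have hdimM : finrank ℝ M ≤ finrank ℝ D := by
    have h1 : finrank ℝ L' + finrank ℝ M = finrank ℝ K := Submodule.finrank_add_eq_of_isCompl hM
    have h2 : finrank ℝ L' = finrank ℝ L := (Submodule.comapSubtypeEquivOfLe hLK).finrank_eq
    rw [finrank_euclideanSpace_fin]
    omega
  obtain ⟨e, he⟩ := exists_basis_diagonal s (fun v w => by simp [s, hb (v : W)])
    (fun v hv => by
      have h1 : ((v : K) : W) ∉ L := fun h => by
        have h2 : (v : K) ∈ L' ⊓ M := ⟨h, v.2⟩
        rw [hM.inf_eq_bot, Submodule.mem_bot] at h2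
        exact hv (Subtype.ext h2)
      have := hneg _ (v : K).2 h1
      simpa [s] using this)
    β (fun X Y => by simp [β, hA X Y]) (fun X Y Z T => by rw [hsβ, hsβ, hs])
    (fun X h => h0 X (hβ0 X X h)) hdimM
  have hD : finrank ℝ D = m := finrank_euclideanSpace_fin
  have hpos (i) : 0 < ‖e i‖ := norm_pos_iff.2 (e.ne_zero i)
  have horth : Orthonormal ℝ fun i => ‖e i‖⁻¹ • e i := by
    refine ⟨fun i => by simp [norm_smul, (hpos i).ne'], fun i j hij => ?_⟩
    have h1 := hν (e i) (e j)
    rw [hLν _ (hβ0 _ _ (he i j hij))] at h1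
    have h2 : inner ℝ (e i) (e j) = 0 := by simpa [hσ.ne'] using h1.symm
    simp [inner_smul_left, inner_smul_right, h2]
  have hspan : ⊤ ≤ Submodule.span ℝ (Set.range fun i => ‖e i‖⁻¹ • e i) := by
    have : LinearIndependent ℝ fun i => ‖e i‖⁻¹ • e i := horth.linearIndependent
    exact (this.span_eq_top_of_card_eq_finrank' (by simp)).ge
  let ε : OrthonormalBasis (Fin m) ℝ D := (OrthonormalBasis.mk horth hspan).reindex (finCongr hD)
  have hε (a : Fin m) : ∃ i c, ε a = c • e i ∧ i = Fin.cast hD.symm a :=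
    ⟨_, _, by simp [ε]; rfl, rfl⟩
  refine ⟨ε, fun a c hac => ?_, fun a => ?_⟩
  · obtain ⟨i, r, h1, hi⟩ := hε a
    obtain ⟨j, t, h2, hj⟩ := hε c
    rw [h1, h2]
    simp only [map_smul, smul_apply]
    refine L.smul_mem _ (L.smul_mem _ (hβ0 _ _ (he i j ?_)))
    rw [hi, hj]
    simpa using hac
  · exact hneg _ (hAK _ _) fun h => (ε.orthonormal.ne_zero a) (h0 _ h)

end Principal

/-! ### The closed forms dual to the principal directions -/

section Lift

open Module Topology Filter

variable {m : ℕ} {W : Type*} [NormedAddCommGroup W] [NormedSpace ℝ W]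

local notation "D" => EuclideanSpace ℝ (Fin m)

/-- A map `G` on `ℝ^m` with totally isotropic differential for the scalar product `b`, which is
conformal with factor `σ` for an auxiliary scalar product `h`, and whose second derivative at each
point is diagonal, modulo the image of the differential, in some orthonormal basis, with
diagonal entries of negative square. -/
structure IsDiagonalIsotropic (b h : W →L[ℝ] W →L[ℝ] ℝ) (G : D → W) (σ : D → ℝ) : Prop where
  contDiff : ContDiff ℝ ∞ G
  symm : ∀ v w, b v w = b w v
  symm' : ∀ v w, h v w = h w v
  isotropic : ∀ y X Y, b (fderiv ℝ G y X) (fderiv ℝ G y Y) = 0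
  conformal : ∀ y X Y, h (fderiv ℝ G y X) (fderiv ℝ G y Y) = σ y * inner ℝ X Y
  contDiff_factor : ContDiff ℝ ∞ σ
  factor_pos : ∀ y, 0 < σ y
  diagonal : ∀ y, ∃ e : OrthonormalBasis (Fin m) ℝ D,
    (∀ a c, a ≠ c → secondDeriv G y (e a) (e c) ∈ (fderiv ℝ G y).range) ∧
    ∀ a, b (secondDeriv G y (e a) (e a)) (secondDeriv G y (e a) (e a)) < 0

variable {b h : W →L[ℝ] W →L[ℝ] ℝ} {G : EuclideanSpace ℝ (Fin m) → W}
  {σ : EuclideanSpace ℝ (Fin m) → ℝ}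

theorem IsDiagonalIsotropic.exists_expansion (H : IsDiagonalIsotropic b h G σ) (y : D) :
    ∃ e : OrthonormalBasis (Fin m) ℝ D, ∃ k : Fin m → ℝ, (∀ a, 0 < k a) ∧
      (∀ X Y Z T, b (secondDeriv G y X Y) (secondDeriv G y Z T) =
        - ∑ a, k a * (inner ℝ (e a) X * inner ℝ (e a) Y * inner ℝ (e a) Z * inner ℝ (e a) T)) ∧
      ∀ X Y, secondDeriv G y X Y -
        ∑ a, (inner ℝ (e a) X * inner ℝ (e a) Y) • secondDeriv G y (e a) (e a)
          ∈ (fderiv ℝ G y).range := by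
  classical
  obtain ⟨e, he, hneg⟩ := H.diagonal y
  set A := secondDeriv G y with hA
  have hL (X Y : D) : A X Y - ∑ a, (inner ℝ (e a) X * inner ℝ (e a) Y) • A (e a) (e a)
      ∈ (fderiv ℝ G y).range := by
    have h1 : A X Y = ∑ a, ∑ c, (inner ℝ (e a) X * inner ℝ (e c) Y) • A (e a) (e c) := by
      conv_lhs => rw [← e.sum_repr' X, ← e.sum_repr' Y]
      simp only [map_sum, map_smul, sum_apply, smul_apply, smul_smul, Finset.smul_sum]
      rw [Finset.sum_comm]
      exact Finset.sum_congr rfl fun a _ => Finset.sum_congr rfl fun c _ => by rw [mul_comm]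
    rw [h1, ← Finset.sum_sub_distrib]
    refine Submodule.sum_mem _ fun a _ => ?_
    rw [← Finset.add_sum_erase _ _ (Finset.mem_univ a), add_sub_cancel_left]
    exact Submodule.sum_mem _ fun c hc =>
      Submodule.smul_mem _ _ (he a c (Finset.ne_of_mem_erase hc).symm)
  have hAL (X Y : D) (l : W) (hl : l ∈ (fderiv ℝ G y).range) : b (A X Y) l = 0 := by
    obtain ⟨s, rfl⟩ := hl
    exact bilin_secondDeriv_fderiv H.contDiff H.symm H.isotropic y X Y s
  obtain ⟨k, hk⟩ : ∃ k : Fin m → ℝ, ∀ a, b (A (e a) (e a)) (A (e a) (e a)) = - k a :=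
    ⟨fun a => - b (A (e a) (e a)) (A (e a) (e a)), fun a => (neg_neg _).symm⟩
  have hdiag (a c : Fin m) : b (A (e a) (e a)) (A (e c) (e c)) = if a = c then - k a else 0 := by
    split_ifs with hac
    · rw [← hac, hk]
    · rw [hA, bilin_secondDeriv_swap H.contDiff H.symm H.isotropic, ← hA]
      exact hAL _ _ _ (he a c hac)
  refine ⟨e, k, fun a => by have := hneg a; rw [hk] at this; linarith, fun X Y Z T => ?_, hL⟩
  have h1 := hAL X Y _ (hL Z T)
  have h2 : b (A X Y - ∑ a, (inner ℝ (e a) X * inner ℝ (e a) Y) • A (e a) (e a))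
      (∑ a, (inner ℝ (e a) Z * inner ℝ (e a) T) • A (e a) (e a)) = 0 := by
    rw [H.symm, map_sum, sum_apply]
    refine Finset.sum_eq_zero fun a _ => ?_
    rw [map_smul, smul_apply, hAL _ _ _ (hL X Y), smul_zero]
  rw [map_sub, sub_eq_zero] at h1
  rw [map_sub, sub_apply, sub_eq_zero] at h2
  rw [h1, h2]
  simp only [map_sum, map_smul, sum_apply, smul_apply, smul_eq_mul, hdiag]
  simp only [mul_ite, mul_zero, Finset.sum_ite_eq', Finset.mem_univ, if_true,
    mul_neg, Finset.sum_neg_distrib]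
  exact congrArg _ (Finset.sum_congr rfl fun a _ => by ring)

/-- The equation `b (G''(Z, Z)) (G''(Z, ·)) + σ ⟪Z, ·⟫ = 0`. In a basis that diagonalizes `G''` its
solutions are the vectors whose coordinates are `0` or `± √(σ / k a)`; in particular they are
isolated, and suitable multiples of the principal directions are among them. -/
def principalEq (b : W →L[ℝ] W →L[ℝ] ℝ) (G : D → W) (σ : D → ℝ) (u : D × D) : D →L[ℝ] ℝ :=
  (b (secondDeriv G u.1 u.2 u.2)) ∘L (secondDeriv G u.1 u.2) + σ u.1 • innerSL ℝ u.2

theorem principalEq_apply (u : D × D) (Y : D) : principalEq b G σ u Y =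
    b (secondDeriv G u.1 u.2 u.2) (secondDeriv G u.1 u.2 Y) + σ u.1 * inner ℝ u.2 Y := by
  simp [principalEq]

theorem IsDiagonalIsotropic.contDiff_principalEq (H : IsDiagonalIsotropic b h G σ) :
    ContDiff ℝ ∞ (principalEq b G σ) := by
  have h1 : ContDiff ℝ ∞ fun u : D × D => secondDeriv G u.1 u.2 :=
    ((contDiff_secondDeriv H.contDiff).comp contDiff_fst).clm_apply contDiff_snd
  have h2 : ContDiff ℝ ∞ fun u : D × D => b (secondDeriv G u.1 u.2 u.2) :=
    b.contDiff.comp (h1.clm_apply contDiff_snd)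
  exact (h2.clm_comp h1).add ((H.contDiff_factor.comp contDiff_fst).smul
    ((innerSL ℝ).contDiff.comp contDiff_snd))

theorem IsDiagonalIsotropic.fderiv_principalEq (H : IsDiagonalIsotropic b h G σ) (u : D × D)
    (T Y : D) : (fderiv ℝ (principalEq b G σ) u ∘L .inr ℝ D D) T Y =
      3 * b (secondDeriv G u.1 u.2 u.2) (secondDeriv G u.1 T Y) + σ u.1 * inner ℝ T Y := by
  obtain ⟨y, Z⟩ := u
  set A := secondDeriv G y with hA
  have h1 : HasFDerivAt (fun Z => principalEq b G σ (y, Z))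
      (fderiv ℝ (principalEq b G σ) (y, Z) ∘L .inr ℝ D D) Z :=
    ((H.contDiff_principalEq.differentiable (by simp) (y, Z)).hasFDerivAt).comp Z
      (hasFDerivAt_prodMk_right y Z)
  have h2 : HasFDerivAt (fun Z => principalEq b G σ (y, Z) Y)
      ((ContinuousLinearMap.apply ℝ ℝ Y).comp
        (fderiv ℝ (principalEq b G σ) (y, Z) ∘L .inr ℝ D D)) Z :=
    (ContinuousLinearMap.apply ℝ ℝ Y).hasFDerivAt.comp Z h1
  have hu : HasFDerivAt (fun Z => A Z Z) (A Z + A.flip Z) Z := by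
    refine (A.hasFDerivAt_of_bilinear (hasFDerivAt_id Z) (hasFDerivAt_id Z)).congr_fderiv ?_
    ext T
    simp
  have hv : HasFDerivAt (fun Z => A Z Y) (A.flip Y) Z := (A.flip Y).hasFDerivAt
  have hw : HasFDerivAt (fun Z => σ y * inner ℝ Z Y) (σ y • innerSL ℝ Y) Z := by
    have : (fun Z : D => σ y * inner ℝ Z Y) = fun Z => (σ y • innerSL ℝ Y) Z := by
      funext Z
      simp [real_inner_comm]
    rw [this]
    exact (σ y • innerSL ℝ Y).hasFDerivAt
  have h3 := (b.hasFDerivAt_of_bilinear hu hv).add hw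
  have h4 : (fun Z => principalEq b G σ (y, Z) Y)
      = (fun Z => b (A Z Z) (A Z Y)) + fun Z => σ y * inner ℝ Z Y := by
    funext Z
    exact principalEq_apply _ _
  rw [h4] at h2
  have h5 := congrArg (fun l => l T) (h2.unique h3)
  have h6 : (fderiv ℝ (principalEq b G σ) (y, Z) ∘L .inr ℝ D D) T Y =
      b (A Z Z) (A T Y) + b (A Z T + A T Z) (A Z Y) + σ y * inner ℝ Y T := by
    simpa using h5
  have h7 : b (A Z T) (A Z Y) = b (A Z Z) (A T Y) := by
    rw [hA, secondDeriv_comm H.contDiff y Z T, bilin_secondDeriv_swap H.contDiff H.symm H.isotropic]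
  rw [h6, map_add, add_apply, hA, secondDeriv_comm H.contDiff y T Z, ← hA, h7,
    real_inner_comm T Y]
  ring

/-- The coordinates of a solution of `principalEq` with respect to a diagonalizing basis. -/
theorem IsDiagonalIsotropic.coord_of_principalEq {y Z : D} {e : OrthonormalBasis (Fin m) ℝ D}
    {k : Fin m → ℝ} (hQ : ∀ X Y Z T, b (secondDeriv G y X Y) (secondDeriv G y Z T) =
      - ∑ a, k a * (inner ℝ (e a) X * inner ℝ (e a) Y * inner ℝ (e a) Z * inner ℝ (e a) T))
    (hZ : principalEq b G σ (y, Z) = 0) (a : Fin m) :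
    inner ℝ (e a) Z = 0 ∨ k a * inner ℝ (e a) Z ^ 2 = σ y := by
  have h1 := principalEq_apply (b := b) (G := G) (σ := σ) (y, Z) (e a)
  rw [hZ, hQ, Finset.sum_eq_single a] at h1
  · simp only [zero_apply, real_inner_self_eq_norm_sq, e.orthonormal.1, real_inner_comm (e a) Z]
      at h1
    have : inner ℝ (e a) Z * (k a * inner ℝ (e a) Z ^ 2 - σ y) = 0 := by
      linear_combination h1
    rcases mul_eq_zero.1 this with h | h
    · exact Or.inl h
    · exact Or.inr (sub_eq_zero.1 h)
  · intro c _ hc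
    rw [e.orthonormal.2 hc]
    ring
  · simp

theorem IsDiagonalIsotropic.isInvertible_fderiv_principalEq (H : IsDiagonalIsotropic b h G σ)
    (u : D × D) (hu : principalEq b G σ u = 0) :
    (fderiv ℝ (principalEq b G σ) u ∘L .inr ℝ D D).IsInvertible := by
  obtain ⟨y, Z⟩ := u
  set l := fderiv ℝ (principalEq b G σ) (y, Z) ∘L .inr ℝ D D with hl
  obtain ⟨e, k, hk, hQ, -⟩ := H.exists_expansion y
  have hinj : Function.Injective l := by
    refine (injective_iff_map_eq_zero l).2 fun T hT => ?_
    refine InnerProductSpace.ext_inner_left_basis e.toBasis fun a => ?_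
    rw [inner_zero_right, e.coe_toBasis]
    have h1 := H.fderiv_principalEq (y, Z) T (e a)
    rw [← hl, hT, hQ, Finset.sum_eq_single a] at h1
    · simp only [zero_apply, real_inner_self_eq_norm_sq, e.orthonormal.1,
        real_inner_comm (e a) T] at h1
      have hσ := H.factor_pos y
      rcases IsDiagonalIsotropic.coord_of_principalEq hQ hu a with h2 | h2
      · rw [h2] at h1
        have : σ y * inner ℝ (e a) T = 0 := by linear_combination -h1
        exact (mul_eq_zero.1 this).resolve_left hσ.ne'
      · have : σ y * inner ℝ (e a) T = 0 := by
          linear_combination h1 / 2 - 3 / 2 * inner ℝ (e a) T * h2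
        exact (mul_eq_zero.1 this).resolve_left hσ.ne'
    · intro c _ hc
      rw [e.orthonormal.2 hc]
      ring
    · simp
  have hfin : finrank ℝ D = finrank ℝ (D →L[ℝ] ℝ) :=
    Subspace.dual_finrank_eq.symm.trans
      (LinearMap.toContinuousLinearMap (𝕜 := ℝ) (E := D) (F' := ℝ)).finrank_eq
  exact ⟨(LinearEquiv.ofInjectiveOfFinrankEq l.toLinearMap hinj hfin).toContinuousLinearEquiv, by
    ext; rfl⟩

theorem IsDiagonalIsotropic.principalEq_self {y Z : D} (hZ : principalEq b G σ (y, Z) = 0) :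
    b (secondDeriv G y Z Z) (secondDeriv G y Z Z) = - (σ y * ‖Z‖ ^ 2) := by
  have := principalEq_apply (b := b) (G := G) (σ := σ) (y, Z) Z
  rw [hZ, real_inner_self_eq_norm_sq] at this
  simp only [zero_apply] at this
  linarith

theorem IsDiagonalIsotropic.quartic_neg (H : IsDiagonalIsotropic b h G σ) (y X : D) (hX : X ≠ 0) :
    b (secondDeriv G y X X) (secondDeriv G y X X) < 0 := by
  obtain ⟨e, k, hk, hQ, -⟩ := H.exists_expansion y
  rw [hQ, neg_lt_zero]
  obtain ⟨a, ha⟩ : ∃ a, inner ℝ (e a) X ≠ 0 := by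
    by_contra! hc
    refine hX (InnerProductSpace.ext_inner_left_basis e.toBasis fun a => ?_)
    rw [e.coe_toBasis, hc, inner_zero_right]
  refine Finset.sum_pos' (fun c _ => ?_) ⟨a, Finset.mem_univ a, ?_⟩
  · have : inner ℝ (e c) X * inner ℝ (e c) X * inner ℝ (e c) X * inner ℝ (e c) X
      = (inner ℝ (e c) X ^ 2) ^ 2 := by ring
    rw [this]
    exact mul_nonneg (hk c).le (by positivity)
  · have : inner ℝ (e a) X * inner ℝ (e a) X * inner ℝ (e a) X * inner ℝ (e a) X
      = (inner ℝ (e a) X ^ 2) ^ 2 := by ring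
    rw [this]
    exact mul_pos (hk a) (by positivity)

theorem IsDiagonalIsotropic.bounded_principalEq (H : IsDiagonalIsotropic b h G σ)
    (K : Set D) (hK : IsCompact K) :
    ∃ C, ∀ y ∈ K, ∀ Z, principalEq b G σ (y, Z) = 0 → ‖Z‖ ≤ C := by
  have hc : Continuous fun u : D × D =>
      - b (secondDeriv G u.1 u.2 u.2) (secondDeriv G u.1 u.2 u.2) := by
    have h1 : Continuous fun u : D × D => secondDeriv G u.1 u.2 u.2 :=
      (((contDiff_secondDeriv H.contDiff).continuous.comp continuous_fst).clm_apply
        continuous_snd).clm_apply continuous_snd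
    exact ((b.continuous.comp h1).clm_apply h1).neg
  rcases (K ×ˢ Metric.sphere (0 : D) 1).eq_empty_or_nonempty with hE | hE
  · refine ⟨0, fun y hy Z _ => ?_⟩
    by_contra hZ
    have hZ0 : ‖Z‖ ≠ 0 := fun h => hZ h.le
    have : (y, ‖Z‖⁻¹ • Z) ∈ K ×ˢ Metric.sphere (0 : D) 1 := ⟨hy, by simp [norm_smul, hZ0]⟩
    rw [hE] at this
    exact this
  obtain ⟨⟨y₀, X₀⟩, hmem, hmin⟩ := (hK.prod (isCompact_sphere (0 : D) 1)).exists_isMinOn hE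
    hc.continuousOn
  obtain ⟨y₁, hy₁, hmax⟩ := hK.exists_isMaxOn ⟨y₀, hmem.1⟩
    H.contDiff_factor.continuous.continuousOn
  set δ := - b (secondDeriv G y₀ X₀ X₀) (secondDeriv G y₀ X₀ X₀) with hδ
  have hδ0 : 0 < δ := neg_pos.2 (H.quartic_neg y₀ X₀ (by
    rintro rfl
    simpa using hmem.2))
  refine ⟨Real.sqrt (σ y₁ / δ), fun y hy Z hZ => ?_⟩
  rcases eq_or_ne Z 0 with rfl | hZ0
  · simp
  have hn : 0 < ‖Z‖ := norm_pos_iff.2 hZ0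
  have h1 : (y, ‖Z‖⁻¹ • Z) ∈ K ×ˢ Metric.sphere (0 : D) 1 := ⟨hy, by simp [norm_smul, hn.ne']⟩
  have h2 := isMinOn_iff.1 hmin _ h1
  simp only [map_smul, smul_apply, smul_eq_mul] at h2
  rw [← hδ, IsDiagonalIsotropic.principalEq_self hZ] at h2
  have h3 : δ * ‖Z‖ ^ 2 ≤ σ y := by
    calc δ * ‖Z‖ ^ 2 ≤ (-(‖Z‖⁻¹ * (‖Z‖⁻¹ * (‖Z‖⁻¹ * (‖Z‖⁻¹ * -(σ y * ‖Z‖ ^ 2)))))) * ‖Z‖ ^ 2 := by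
          gcongr
      _ = σ y := by field_simp
  have h4 : σ y ≤ σ y₁ := isMaxOn_iff.1 hmax y hy
  refine Real.le_sqrt_of_sq_le ?_
  rw [le_div_iff₀ hδ0]
  linarith

/-- The number of nonzero coordinates of a solution of `principalEq`, as a trace. -/
theorem IsDiagonalIsotropic.trace_principalEq (H : IsDiagonalIsotropic b h G σ) {y Z : D}
    {e : OrthonormalBasis (Fin m) ℝ D}
    {k : Fin m → ℝ} (hQ : ∀ X Y Z T, b (secondDeriv G y X Y) (secondDeriv G y Z T) =
      - ∑ a, k a * (inner ℝ (e a) X * inner ℝ (e a) Y * inner ℝ (e a) Z * inner ℝ (e a) T))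
    (hZ : principalEq b G σ (y, Z) = 0) :
    - (∑ i, b (secondDeriv G y Z Z) (secondDeriv G y (EuclideanSpace.basisFun (Fin m) ℝ i)
        (EuclideanSpace.basisFun (Fin m) ℝ i))) / σ y
      = ((Finset.univ.filter fun a => inner ℝ (e a) Z ≠ 0).card : ℝ) := by
  have hσ := H.factor_pos y
  rw [div_eq_iff hσ.ne']
  simp only [hQ, Finset.sum_neg_distrib, neg_neg]
  rw [Finset.sum_comm, Finset.card_filter]
  push_cast
  rw [Finset.sum_mul]
  refine Finset.sum_congr rfl fun a _ => ?_
  have h1 : ∑ i, inner ℝ (e a) (EuclideanSpace.basisFun (Fin m) ℝ i) ^ 2 = 1 := by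
    have h2 := (EuclideanSpace.basisFun (Fin m) ℝ).sum_sq_norm_inner_left (e a)
    simpa [e.orthonormal.1 a] using h2
  have h3 : ∑ i, k a * (inner ℝ (e a) Z * inner ℝ (e a) Z *
      inner ℝ (e a) (EuclideanSpace.basisFun (Fin m) ℝ i) *
        inner ℝ (e a) (EuclideanSpace.basisFun (Fin m) ℝ i)) = k a * inner ℝ (e a) Z ^ 2 := by
    calc _ = ∑ i, k a * inner ℝ (e a) Z ^ 2 *
          inner ℝ (e a) (EuclideanSpace.basisFun (Fin m) ℝ i) ^ 2 :=
          Finset.sum_congr rfl fun i _ => by ring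
      _ = _ := by rw [← Finset.mul_sum, h1, mul_one]
  rw [h3]
  rcases IsDiagonalIsotropic.coord_of_principalEq hQ hZ a with h2 | h2
  · simp [h2]
  · have : inner ℝ (e a) Z ≠ 0 := by
      intro h4
      rw [h4] at h2
      norm_num at h2
      exact hσ.ne h2
    rw [if_pos this, h2, one_mul]

/-- A principal direction at one point extends to a global smooth field of principal directions:
the solutions of `principalEq` form a covering, and the number of nonzero coordinates of a
continuous family of solutions is constant. -/
theorem IsDiagonalIsotropic.exists_principal_field (H : IsDiagonalIsotropic b h G σ)
    (hm : 0 < m) : ∃ Z : D → D, ContDiff ℝ ∞ Z ∧ (∀ y, Z y ≠ 0) ∧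
      (∀ y, principalEq b G σ (y, Z y) = 0) ∧
      ∀ y X, ∃ s, secondDeriv G y X (Z y) - ((‖Z y‖ ^ 2)⁻¹ * inner ℝ (Z y) X) •
        secondDeriv G y (Z y) (Z y) = fderiv ℝ G y s := by
  classical
  obtain ⟨e, k, hk, hQ, -⟩ := H.exists_expansion 0
  set a₀ : Fin m := ⟨0, hm⟩
  set r := Real.sqrt (σ 0 / k a₀) with hr
  have hr2 : r ^ 2 = σ 0 / k a₀ := Real.sq_sqrt (div_pos (H.factor_pos 0) (hk a₀)).le
  have hr0 : 0 < r := Real.sqrt_pos.2 (div_pos (H.factor_pos 0) (hk a₀))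
  have hco (a : Fin m) : inner ℝ (e a) (r • e a₀) = if a = a₀ then r else 0 := by
    rw [inner_smul_right, e.inner_eq_ite]
    split_ifs <;> simp
  have hZ₀ : principalEq b G σ (0, r • e a₀) = 0 := by
    refine ContinuousLinearMap.ext fun Y => ?_
    rw [principalEq_apply, hQ]
    simp only [hco, zero_apply]
    rw [Finset.sum_eq_single a₀]
    · have : k a₀ * r ^ 2 = σ 0 := by rw [hr2]; field_simp [(hk a₀).ne']
      simp only [if_true, inner_smul_left]
      simp
      linear_combination (-(r * inner ℝ (e a₀) Y)) * this
    · intro c _ hc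
      simp [hc]
    · simp
  obtain ⟨Z, hZs, hZ0, hZ⟩ := exists_contDiff_section H.contDiff_principalEq
    H.isInvertible_fderiv_principalEq H.bounded_principalEq (0, r • e a₀) hZ₀
  -- `n y` counts the nonzero coordinates of `Z y`. It is a continuous function of `y`, as a trace,
  -- although the diagonalizing bases `ε y` need not depend continuously on `y`.
  choose ε κ hκ hκQ hκL using H.exists_expansion
  let n : D → ℕ := fun y => (Finset.univ.filter fun a => inner ℝ (ε y a) (Z y) ≠ 0).card
  have hn : Continuous n := by
    rw [Nat.isClosedEmbedding_coe_real.isInducing.continuous_iff]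
    have h1 : Nat.cast ∘ n = fun y => - (∑ i, b (secondDeriv G y (Z y) (Z y))
        (secondDeriv G y (EuclideanSpace.basisFun (Fin m) ℝ i)
          (EuclideanSpace.basisFun (Fin m) ℝ i))) / σ y :=
      funext fun y => (H.trace_principalEq (hκQ y) (hZ y)).symm
    rw [h1]
    refine Continuous.div ?_ H.contDiff_factor.continuous fun y => (H.factor_pos y).ne'
    refine (continuous_finsetSum _ fun i _ => ?_).neg
    exact (b.continuous.comp (contDiff_secondDeriv_apply H.contDiff hZs hZs).continuous).clm_apply
      (contDiff_secondDeriv_apply H.contDiff contDiff_const contDiff_const).continuous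
  have hn1 (y : D) : n y = 1 := by
    have h0 : (n 0 : ℝ) = 1 := by
      have h1 := (H.trace_principalEq (hκQ 0) (hZ 0)).symm
      rw [H.trace_principalEq hQ (hZ 0)] at h1
      change (n 0 : ℝ) = _ at h1
      rw [h1]
      simp only at hZ0
      rw [hZ0]
      have : (Finset.univ.filter fun a => inner ℝ (e a) (r • e a₀) ≠ 0) = {a₀} := by
        ext a
        rw [Finset.mem_filter, hco]
        simp [hr0.ne']
      rw [this]
      simp
    rw [PreconnectedSpace.constant inferInstance hn (x := y) (y := 0)]
    exact_mod_cast h0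
  have hone (y : D) : ∃ a, inner ℝ (ε y a) (Z y) ≠ 0 ∧ Z y = inner ℝ (ε y a) (Z y) • ε y a := by
    obtain ⟨a, ha⟩ := Finset.card_eq_one.1 (hn1 y)
    have h1 (c : Fin m) : inner ℝ (ε y c) (Z y) ≠ 0 ↔ c = a := by
      have := Finset.ext_iff.1 ha c
      simpa using this
    refine ⟨a, (h1 a).2 rfl, ?_⟩
    conv_lhs => rw [← (ε y).sum_repr' (Z y)]
    refine Finset.sum_eq_single a (fun c _ hc => ?_) (by simp)
    have : inner ℝ (ε y c) (Z y) = 0 := by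
      by_contra h
      exact hc ((h1 c).1 h)
    rw [this, zero_smul]
  refine ⟨Z, hZs, fun y h => ?_, hZ, fun y X => ?_⟩
  · obtain ⟨a, ha, -⟩ := hone y
    rw [h] at ha
    simp at ha
  · obtain ⟨a, ha, hZa⟩ := hone y
    set z := inner ℝ (ε y a) (Z y) with hz
    obtain ⟨s, hs⟩ := hκL y X (ε y a)
    refine ⟨z • s, ?_⟩
    have h1 : ‖Z y‖ ^ 2 = z ^ 2 := by
      rw [hZa, norm_smul, (ε y).orthonormal.1 a]
      simp
    have h2 : inner ℝ (Z y) X = z * inner ℝ (ε y a) X := by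
      rw [hZa, inner_smul_left]
      simp
    have h3 : ∑ c, (inner ℝ (ε y c) X * inner ℝ (ε y c) (ε y a)) •
        secondDeriv G y (ε y c) (ε y c) =
        inner ℝ (ε y a) X • secondDeriv G y (ε y a) (ε y a) := by
      rw [Finset.sum_eq_single a]
      · rw [real_inner_self_eq_norm_sq, (ε y).orthonormal.1 a]
        simp
      · intro c _ hc
        rw [(ε y).orthonormal.2 hc]
        simp
      · simp
    rw [h3] at hs
    rw [map_smul]
    change (fderiv ℝ G y) s = _ at hs
    rw [hs, h1, h2, hZa]
    simp only [map_smul, smul_apply, smul_sub, smul_smul]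
    congr 2
    field_simp

/-- A map as in `IsDiagonalIsotropic` gives a function `u` without critical points, whose
differential is dual to a field of principal directions. -/
theorem IsDiagonalIsotropic.exists_potential (H : IsDiagonalIsotropic b h G σ) (hm : 0 < m) :
    ∃ (u : D → ℝ) (Z : D → D), (∀ y, Z y ≠ 0) ∧
      (∀ y, HasFDerivAt u ((‖Z y‖ ^ 2)⁻¹ • innerSL ℝ (Z y)) y) ∧
      ∀ y, b (secondDeriv G y (Z y) (Z y)) (secondDeriv G y (Z y) (Z y))
        = - (σ y * ‖Z y‖ ^ 2) := by
  obtain ⟨Z, hZs, hZ0, hZ, hL⟩ := H.exists_principal_field hm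
  have hn (y : D) : ‖Z y‖ ^ 2 ≠ 0 := pow_ne_zero 2 (norm_ne_zero_iff.2 (hZ0 y))
  set θ : D → D →L[ℝ] ℝ := fun y => (‖Z y‖ ^ 2)⁻¹ • innerSL ℝ (Z y) with hθ
  have cθ : ContDiff ℝ ∞ θ :=
    ((hZs.norm_sq ℝ).inv hn).smul ((innerSL ℝ).contDiff.comp hZs)
  have hq (y : D) := IsDiagonalIsotropic.principalEq_self (hZ y)
  have hsymm (y X Y : D) : fderiv ℝ θ y X Y = fderiv ℝ θ y Y X := by
    refine fderiv_dualForm_symm H.contDiff H.symm H.isotropic H.symm' hZs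
      (p := fun y => σ y * ‖Z y‖ ^ 2) (fun y => ?_)
      (fun y => mul_ne_zero (H.factor_pos y).ne' (hn y)) (cθ.differentiable (by simp))
      (fun y X => ?_) hq (fun y X => ?_) y X Y
    · rw [H.conformal, real_inner_self_eq_norm_sq]
    · rw [H.conformal]
      simp only [hθ, smul_apply, innerSL_apply_apply, smul_eq_mul]
      have := norm_ne_zero_iff.2 (hZ0 y)
      field_simp
    · obtain ⟨s, hs⟩ := hL y X
      exact ⟨s, by simpa [hθ] using hs⟩
  obtain ⟨u, hu⟩ := convex_univ.exists_forall_hasFDerivAt_of_fderiv_symmetric isOpen_univ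
    (cθ.differentiable (by simp)).differentiableOn (fun y _ => hsymm y)
  exact ⟨u, Z, hZ0, fun y => hu y (Set.mem_univ y), hq⟩

end Lift

/-! ### Functions with quadratically decaying differential -/

section CriticalPoint

open Module Metric

variable {E : Type*} [NormedAddCommGroup E] [InnerProductSpace ℝ E]

theorem exists_norm_eq_inner_eq_zero [FiniteDimensional ℝ E] (hE : 2 ≤ finrank ℝ E) (y y' : E)
    {r : ℝ} (hr : 0 < r) :
    ∃ w : E, ‖w‖ = r ∧ inner ℝ w y = 0 ∧ 0 ≤ inner ℝ w y' := by
  have h1 : (ℝ ∙ y)ᗮ ≠ ⊥ := by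
    intro h
    have h2 := (ℝ ∙ y).finrank_add_finrank_orthogonal
    rw [h, finrank_bot] at h2
    have := finrank_span_le_card (R := ℝ) ({y} : Set E)
    simp only [Set.toFinset_singleton, Finset.card_singleton] at this
    omega
  obtain ⟨w, hw, hw0⟩ := Submodule.exists_mem_ne_zero_of_ne_bot h1
  have hwy : inner ℝ w y = 0 := by
    rw [real_inner_comm]
    exact Submodule.mem_orthogonal_singleton_iff_inner_right.1 hw
  have hn : 0 < ‖w‖ := norm_pos_iff.2 hw0
  rcases le_total 0 (inner ℝ w y') with h | h
  · refine ⟨(r / ‖w‖) • w, ?_, ?_, ?_⟩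
    · rw [norm_smul, Real.norm_of_nonneg (by positivity), div_mul_cancel₀ _ hn.ne']
    · rw [inner_smul_left, hwy, mul_zero]
    · rw [real_inner_smul_left]; positivity
  · refine ⟨(-(r / ‖w‖)) • w, ?_, ?_, ?_⟩
    · rw [norm_smul, norm_neg, Real.norm_of_nonneg (by positivity), div_mul_cancel₀ _ hn.ne']
    · rw [inner_smul_left, hwy, mul_zero]
    · rw [real_inner_smul_left]
      have : 0 ≤ r / ‖w‖ := by positivity
      nlinarith

theorem abs_sub_le_of_inner_nonneg {u : E → ℝ} (hu : Differentiable ℝ u) {C : ℝ}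
    (hC : ∀ y, ‖fderiv ℝ u y‖ ≤ C / (1 + ‖y‖ ^ 2)) {y w : E} {r : ℝ} (hr : 0 < r)
    (hy : ‖y‖ = r) (hw : ‖w‖ = r) (hyw : 0 ≤ inner ℝ y w) : |u w - u y| ≤ 4 * C / r := by
  have hC0 : 0 ≤ C := by
    have := (norm_nonneg _).trans (hC 0)
    simpa using this
  have hb : ∀ z ∈ segment ℝ y w, ‖fderiv ℝ u z‖ ≤ C / (1 + r ^ 2 / 2) := by
    rintro _ ⟨s, t, hs, ht, hst, rfl⟩
    refine (hC _).trans (div_le_div_of_nonneg_left hC0 (by positivity) ?_)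
    have h1 : ‖s • y + t • w‖ ^ 2 = s ^ 2 * r ^ 2 + 2 * (s * t * inner ℝ y w) + t ^ 2 * r ^ 2 := by
      rw [norm_add_sq_real, norm_smul, norm_smul, hy, hw, real_inner_smul_left,
        real_inner_smul_right, mul_pow, mul_pow, Real.norm_of_nonneg hs, Real.norm_of_nonneg ht]
      ring
    have h2 : 0 ≤ s * t * inner ℝ y w := by positivity
    have h3 : s ^ 2 + t ^ 2 ≥ 1 / 2 := by nlinarith [sq_nonneg (s - t)]
    rw [h1]
    nlinarith [sq_nonneg r]
  have h1 := (convex_segment y w).norm_image_sub_le_of_norm_fderiv_le (𝕜 := ℝ) (fun z _ => hu z) hb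
    (left_mem_segment ℝ y w) (right_mem_segment ℝ y w)
  rw [Real.norm_eq_abs] at h1
  have h2 : ‖w - y‖ ≤ 2 * r := (norm_sub_le _ _).trans (by rw [hy, hw]; linarith)
  calc |u w - u y| ≤ C / (1 + r ^ 2 / 2) * (2 * r) :=
        h1.trans (mul_le_mul_of_nonneg_left h2 (by positivity))
    _ ≤ 4 * C / r := by
        rw [div_mul_eq_mul_div, div_le_div_iff₀ (by positivity) hr]
        nlinarith

/-- In dimension at least two, a function whose differential is `O(|y|⁻²)` has a critical point:
its oscillation on large spheres tends to `0`, so that on a large ball the maximum and the minimum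
cannot both lie on the boundary unless the function is constant. -/
theorem exists_fderiv_eq_zero [FiniteDimensional ℝ E] (hE : 2 ≤ finrank ℝ E)
    {u : E → ℝ} (hu : Differentiable ℝ u) {C : ℝ}
    (hC : ∀ y, ‖fderiv ℝ u y‖ ≤ C / (1 + ‖y‖ ^ 2)) : ∃ y, fderiv ℝ u y = 0 := by
  by_contra! hne
  obtain ⟨a, c, hac⟩ : ∃ a c, u a < u c := by
    by_contra! h
    refine hne 0 ?_
    have : u = fun _ => u 0 := funext fun y => le_antisymm (h 0 y) (h y 0)
    rw [this]
    simp
  obtain ⟨r, hr⟩ : ∃ r : ℝ, ‖a‖ + ‖c‖ + 1 + 8 * |C| / (u c - u a) ≤ r := ⟨_, le_rfl⟩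
  have hδ : 0 < u c - u a := sub_pos.2 hac
  have hq : 0 ≤ 8 * |C| / (u c - u a) := by positivity
  have hr0 : 0 < r := by linarith [norm_nonneg a, norm_nonneg c]
  have ha : a ∈ closedBall (0 : E) r := by
    rw [mem_closedBall_zero_iff]; linarith [norm_nonneg c]
  have hc : c ∈ closedBall (0 : E) r := by
    rw [mem_closedBall_zero_iff]; linarith [norm_nonneg a]
  obtain ⟨x, hx, hmax⟩ := (isCompact_closedBall (0 : E) r).exists_isMaxOn ⟨a, ha⟩
    hu.continuous.continuousOn
  obtain ⟨x', hx', hmin⟩ := (isCompact_closedBall (0 : E) r).exists_isMinOn ⟨a, ha⟩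
    hu.continuous.continuousOn
  have hbd : ∀ z ∈ closedBall (0 : E) r, ¬ closedBall (0 : E) r ∈ nhds z → ‖z‖ = r := by
    intro z hz h
    rw [mem_closedBall_zero_iff] at hz
    refine le_antisymm hz (not_lt.1 fun hlt => h ?_)
    exact Filter.mem_of_superset (isOpen_ball.mem_nhds (mem_ball_zero_iff.2 hlt))
      ball_subset_closedBall
  have hxr := hbd x hx fun h => hne x (hmax.isLocalMax h).fderiv_eq_zero
  have hxr' := hbd x' hx' fun h => hne x' (hmin.isLocalMin h).fderiv_eq_zero
  obtain ⟨w, hw, hwx, hwx'⟩ := exists_norm_eq_inner_eq_zero hE x x' hr0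
  have h1 := abs_sub_le_of_inner_nonneg hu hC hr0 hw hxr hwx.ge
  have h2 := abs_sub_le_of_inner_nonneg hu hC hr0 hw hxr' hwx'
  have h3 := hmax hc
  have h4 := hmin ha
  simp only [Set.mem_ofPred_eq] at h3 h4
  have h5 : u c - u a ≤ 8 * |C| / r := by
    have := le_abs_self C
    have h6 : 4 * C / r ≤ 4 * |C| / r := by gcongr
    have h7 : 8 * |C| / r = 4 * |C| / r + 4 * |C| / r := by ring
    rw [abs_le] at h1 h2
    linarith
  rw [le_div_iff₀ hr0] at h5
  have h6 : 8 * |C| / (u c - u a) < r := by linarith [norm_nonneg a, norm_nonneg c]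
  rw [div_lt_iff₀ hδ] at h6
  linarith

end CriticalPoint

/-! ### Isotropic lifts into spaces of bounded index -/

section Signature

open Module Topology

variable {m : ℕ} {W : Type*} [NormedAddCommGroup W] [NormedSpace ℝ W]
  {b h : W →L[ℝ] W →L[ℝ] ℝ} {G : EuclideanSpace ℝ (Fin m) → W}
  {σ : EuclideanSpace ℝ (Fin m) → ℝ}

local notation "D" => EuclideanSpace ℝ (Fin m)

theorem nonneg_of_mem_sup_span {b : W →L[ℝ] W →L[ℝ] ℝ} (hb : ∀ v w, b v w = b w v)
    {P : Submodule ℝ W} (hP : ∀ p ∈ P, 0 ≤ b p p) {w : W} (hw : 0 ≤ b w w)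
    (hPw : ∀ p ∈ P, b p w = 0) : ∀ p ∈ P ⊔ Submodule.span ℝ {w}, 0 ≤ b p p := by
  intro p hp
  obtain ⟨x, hx, z, hz, rfl⟩ := Submodule.mem_sup.1 hp
  obtain ⟨t, rfl⟩ := Submodule.mem_span_singleton.1 hz
  simp only [map_add, map_smul, add_apply, smul_apply, smul_eq_mul, hb w x, hPw x hx]
  nlinarith [hP x hx, mul_nonneg (mul_self_nonneg t) hw]

/-- The isotropic lift `G` of a conformal immersion is diagonal as soon as the non-negative
subspaces of `b` are small. The orthogonal complement `K` of `G` and of the image `L` of its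
differential contains the second derivatives; as `K` has dimension `dim L + m` and `b` is negative
on `K ∖ L`, Cartan's theorem applies. -/
theorem isDiagonalIsotropic_of_signature [FiniteDimensional ℝ W]
    (hG : ContDiff ℝ ∞ G) (hb : ∀ v w, b v w = b w v) (hh : ∀ v w, h v w = h w v)
    (hnull : ∀ y X Y, b (fderiv ℝ G y X) (fderiv ℝ G y Y) = 0)
    (hconf : ∀ y X Y, h (fderiv ℝ G y X) (fderiv ℝ G y Y) = σ y * inner ℝ X Y)
    (hσ : ContDiff ℝ ∞ σ) (hσ0 : ∀ y, 0 < σ y)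
    {κ : ℝ} (hκ : κ ≠ 0) (hGG : ∀ y, b (G y) (G y) = κ)
    {ν : D → W} (hν : ContDiff ℝ ∞ ν) (hGν : ∀ y X, b (fderiv ℝ G y X) (ν y) = 0)
    (hνν : ∀ y X Y, b (fderiv ℝ G y X) (fderiv ℝ ν y Y) = - (σ y * inner ℝ X Y))
    (hnd : ∀ w, (∀ v, b w v = 0) → w = 0) (hW : finrank ℝ W = 3 * m + 1)
    {q : ℕ} (hq : ∀ P : Submodule ℝ W, (∀ p ∈ P, 0 ≤ b p p) → finrank ℝ P ≤ q)
    (hqκ : q ≤ m ∨ q ≤ m + 1 ∧ 0 < κ) :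
    IsDiagonalIsotropic b h G σ := by
  refine ⟨hG, hb, hh, hnull, hconf, hσ, hσ0, fun y => ?_⟩
  have dG : Differentiable ℝ G := hG.differentiable (by simp)
  have dDG (X : D) : DifferentiableAt ℝ (fun y => fderiv ℝ G y X) y :=
    (contDiff_fderiv_apply hG contDiff_const).differentiable (by simp) y
  have hbG (y X : D) : b (fderiv ℝ G y X) (G y) = 0 := by
    have h1 := fderiv_bilin_apply b (dG y) (dG y) X
    simp only [hGG, fderiv_fun_const, Pi.zero_apply, zero_apply, hb (G y) (fderiv ℝ G y X)] at h1
    linarith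
  have hAG (X Y : D) : b (secondDeriv G y X Y) (G y) = 0 := by
    have h1 := fderiv_bilin_apply b (dDG Y) (dG y) X
    simp only [hbG, fderiv_fun_const, fderiv_fderiv_apply hG contDiff_const, hnull] at h1
    simpa using h1.symm
  have hAν (X Y : D) : b (secondDeriv G y X Y) (ν y) = σ y * inner ℝ X Y := by
    have h1 := fderiv_bilin_apply b (dDG Y) (hν.differentiable (by simp) y) X
    simp only [hGν, fderiv_fun_const, fderiv_fderiv_apply hG contDiff_const, hνν] at h1
    simp only [Pi.zero_apply, zero_apply, map_zero, add_zero] at h1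
    rw [real_inner_comm]
    linarith
  set L : Submodule ℝ W := (fderiv ℝ G y).range with hL
  have hLrank : finrank ℝ L = m := by
    have hinj : Function.Injective (fderiv ℝ G y : D →ₗ[ℝ] W) := by
      rw [← LinearMap.ker_eq_bot, LinearMap.ker_eq_bot']
      intro X hX
      have hX' : fderiv ℝ G y X = 0 := hX
      have h1 := hconf y X X
      rw [hX', map_zero, real_inner_self_eq_norm_sq] at h1
      simpa [(hσ0 y).ne'] using h1.symm
    have := LinearMap.finrank_range_of_inj hinj
    rw [finrank_euclideanSpace_fin] at this
    exact this
  have hLL : ∀ l ∈ L, ∀ l' ∈ L, b l l' = 0 := by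
    rintro _ ⟨X, rfl⟩ _ ⟨Y, rfl⟩
    exact hnull y X Y
  have hLG : ∀ l ∈ L, b l (G y) = 0 := by
    rintro _ ⟨X, rfl⟩
    exact hbG y X
  have hGL : G y ∉ L := fun hmem => hκ (by rw [← hGG y]; exact hLG _ hmem)
  let b' : LinearMap.BilinForm ℝ W := LinearMap.mk₂ ℝ (fun v w => b v w) (by simp) (by simp)
    (by simp) (by simp)
  set S : Submodule ℝ W := L ⊔ Submodule.span ℝ {G y} with hS
  set K : Submodule ℝ W := b'.orthogonal S with hKdef
  have hK (k : W) : k ∈ K ↔ (∀ l ∈ L, b l k = 0) ∧ b (G y) k = 0 := by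
    rw [hKdef, LinearMap.BilinForm.mem_orthogonal_iff]
    constructor
    · intro hk
      exact ⟨fun l hl => hk l (Submodule.mem_sup_left hl),
        hk _ (Submodule.mem_sup_right (Submodule.mem_span_singleton_self _))⟩
    · rintro ⟨h1, h2⟩ n hn
      obtain ⟨x, hx, z, hz, rfl⟩ := Submodule.mem_sup.1 hn
      obtain ⟨t, rfl⟩ := Submodule.mem_span_singleton.1 hz
      change b (x + t • G y) k = 0
      rw [map_add, map_smul, add_apply, smul_apply, h1 x hx, h2, smul_zero, add_zero]
  have hKrank : finrank ℝ K = 2 * m := by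
    have h1 := LinearMap.BilinForm.finrank_add_finrank_orthogonal' (B := b') S
    have hker : LinearMap.ker b' = ⊥ := by
      rw [LinearMap.ker_eq_bot']
      intro w hw
      exact hnd w fun v => LinearMap.congr_fun hw v
    rw [hker, inf_bot_eq, finrank_bot, hW, hS, Submodule.finrank_sup_span_singleton hGL,
      hLrank] at h1
    change _ + finrank ℝ K = _ at h1
    omega
  have hLK : L ≤ K := fun l hl =>
    (hK l).2 ⟨fun l' hl' => hLL l' hl' l hl, by rw [hb]; exact hLG l hl⟩
  refine exists_orthonormalBasis_diagonal hb (secondDeriv_comm hG y)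
    (bilin_secondDeriv_swap hG hb hnull y) hLK (fun l hl k hk => ((hK k).1 hk).1 l hl) ?_
    (by rw [hKrank, hLrank]; omega) ?_ (hσ0 y) hAν ?_
  · intro w hw hwL
    by_contra! hw0
    obtain ⟨hw1, hw2⟩ := (hK w).1 hw
    have hP : ∀ p ∈ L ⊔ Submodule.span ℝ {w}, 0 ≤ b p p :=
      nonneg_of_mem_sup_span hb (fun p hp => (hLL p hp p hp).ge) hw0 hw1
    have hPrank : finrank ℝ ↥(L ⊔ Submodule.span ℝ {w}) = m + 1 := by
      rw [Submodule.finrank_sup_span_singleton hwL, hLrank]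
    rcases hqκ with hq' | ⟨hq', hκ0⟩
    · have := hq _ hP
      omega
    -- `G y` enlarges the nonnegative subspace when its square `κ` is positive
    · have hPK : L ⊔ Submodule.span ℝ {w} ≤ K :=
        sup_le hLK ((Submodule.span_singleton_le_iff_mem _ _).2 hw)
      have hGP : G y ∉ L ⊔ Submodule.span ℝ {w} := fun hmem =>
        hκ (by rw [← hGG y]; exact ((hK _).1 (hPK hmem)).2)
      have h1 := hq _ (nonneg_of_mem_sup_span hb hP (by rw [hGG y]; exact hκ0.le)
        (fun p hp => by rw [hb]; exact ((hK p).1 (hPK hp)).2))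
      rw [Submodule.finrank_sup_span_singleton hGP, hPrank] at h1
      omega
  · intro X Y
    refine (hK _).2 ⟨?_, by rw [hb]; exact hAG X Y⟩
    rintro _ ⟨Z, rfl⟩
    change b (fderiv ℝ G y Z) _ = 0
    rw [hb]
    exact bilin_secondDeriv_fderiv hG hb hnull y X Y Z
  · rintro _ ⟨X, rfl⟩
    exact hGν y X

end Signature

/-! ### Pairs of charts exchanged by an inversion -/

section Inversion

open Module Topology Metric

variable {m : ℕ} {W : Type*} [NormedAddCommGroup W] [NormedSpace ℝ W]
  {b h : W →L[ℝ] W →L[ℝ] ℝ} {G G' : EuclideanSpace ℝ (Fin m) → W}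
  {σ σ' : EuclideanSpace ℝ (Fin m) → ℝ}

local notation "D" => EuclideanSpace ℝ (Fin m)

theorem IsDiagonalIsotropic.exists_bound_closedBall (H : IsDiagonalIsotropic b h G σ) :
    ∃ C, ∀ y ∈ closedBall (0 : D) 1, ∀ X, - b (secondDeriv G y X X) (secondDeriv G y X X)
      ≤ C * h (fderiv ℝ G y X) (fderiv ℝ G y X) ^ 2 := by
  have hc : Continuous fun y => ‖b‖ * ‖secondDeriv G y‖ ^ 2 / σ y ^ 2 := by
    have h1 := (contDiff_secondDeriv H.contDiff).continuous
    have h2 := H.contDiff_factor.continuous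
    have h3 (y : D) : σ y ^ 2 ≠ 0 := pow_ne_zero 2 (H.factor_pos y).ne'
    have h4 : Continuous fun y => ‖b‖ * ‖secondDeriv G y‖ ^ 2 :=
      continuous_const.mul ((continuous_pow 2).comp
        ((continuous_norm (E := D →L[ℝ] D →L[ℝ] W)).comp h1))
    exact h4.div ((continuous_pow 2).comp h2) h3
  obtain ⟨C, hC⟩ := (isCompact_closedBall (0 : D) 1).bddAbove_image hc.continuousOn
  refine ⟨C, fun y hy X => ?_⟩
  have h1 := hC (Set.mem_image_of_mem _ hy)
  have hσ := H.factor_pos y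
  rw [div_le_iff₀ (by positivity)] at h1
  have h2 := (neg_le_abs _).trans ((Real.norm_eq_abs _).symm.le.trans
    (b.le_opNorm₂ (secondDeriv G y X X) (secondDeriv G y X X)))
  have h3 : ‖secondDeriv G y X X‖ ≤ ‖secondDeriv G y‖ * ‖X‖ * ‖X‖ :=
    (secondDeriv G y).le_opNorm₂ X X
  rw [H.conformal, real_inner_self_eq_norm_sq]
  calc _ ≤ ‖b‖ * ‖secondDeriv G y X X‖ * ‖secondDeriv G y X X‖ := h2
    _ ≤ ‖b‖ * (‖secondDeriv G y‖ * ‖X‖ * ‖X‖) * (‖secondDeriv G y‖ * ‖X‖ * ‖X‖) := by gcongr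
    _ = ‖b‖ * ‖secondDeriv G y‖ ^ 2 * ‖X‖ ^ 4 := by ring
    _ ≤ C * σ y ^ 2 * ‖X‖ ^ 4 := by gcongr
    _ = _ := by ring

/-- The square of the second derivative of an isotropic map is invariant under changes of
variables. -/
theorem secondDeriv_comp_sq (hG : ContDiff ℝ ∞ G') (hb : ∀ v w, b v w = b w v)
    (hnull : ∀ y X Y, b (fderiv ℝ G' y X) (fderiv ℝ G' y Y) = 0) {j : D → D} {y : D}
    (hj : ContDiffAt ℝ ∞ j y) (hGj : G =ᶠ[𝓝 y] G' ∘ j) (X : D) :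
    fderiv ℝ G y X = fderiv ℝ G' (j y) (fderiv ℝ j y X) ∧
    (DifferentiableAt ℝ (fderiv ℝ G) y → b (secondDeriv G y X X) (secondDeriv G y X X) =
      b (secondDeriv G' (j y) (fderiv ℝ j y X) (fderiv ℝ j y X))
        (secondDeriv G' (j y) (fderiv ℝ j y X) (fderiv ℝ j y X))) := by
  have dG : Differentiable ℝ G' := hG.differentiable (by simp)
  have hev : ∀ᶠ z in 𝓝 y, fderiv ℝ G z X = fderiv ℝ G' (j z) (fderiv ℝ j z X) := by
    have hjd : ∀ᶠ z in 𝓝 y, DifferentiableAt ℝ j z :=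
      (((hj.of_le (m := 1) (by simp)).eventually (by simp)).mono fun z hz =>
        hz.differentiableAt (by simp))
    filter_upwards [hGj.eventuallyEq_nhds, hjd] with z hz hdz
    rw [hz.fderiv_eq, fderiv_comp z (dG _) hdz]
    rfl
  refine ⟨hev.self_of_nhds, fun hd => ?_⟩
  have h1 : HasFDerivAt (fun z => fderiv ℝ G z X)
      ((ContinuousLinearMap.apply ℝ W X).comp (secondDeriv G y)) y :=
    (ContinuousLinearMap.apply ℝ W X).hasFDerivAt.comp y hd.hasFDerivAt
  have dG' : DifferentiableAt ℝ (fderiv ℝ G') (j y) :=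
    (hG.fderiv_right (m := ∞) (by simp)).differentiable (by simp) _
  have dj : DifferentiableAt ℝ j y := hj.differentiableAt (by simp)
  have ddj : DifferentiableAt ℝ (fun z => fderiv ℝ j z X) y := by
    have h2 : DifferentiableAt ℝ (fderiv ℝ j) y :=
      (hj.fderiv_right (m := ∞) (by simp)).differentiableAt (by simp)
    exact (h2.hasFDerivAt.clm_apply (hasFDerivAt_const X y)).differentiableAt
  have h2 := (dG'.hasFDerivAt.comp y dj.hasFDerivAt).clm_apply ddj.hasFDerivAt
  have h3 := congrArg (fun T : D →L[ℝ] W => T X)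
    ((h1.congr_of_eventuallyEq (hev.mono fun _ hz => hz.symm)).unique h2)
  have h4 : secondDeriv G y X X = secondDeriv G' (j y) (fderiv ℝ j y X) (fderiv ℝ j y X)
      + fderiv ℝ G' (j y) (fderiv ℝ (fun z => fderiv ℝ j z X) y X) := by
    rw [add_comm]
    exact h3
  rw [h4]
  simp only [map_add, add_apply, hnull, bilin_secondDeriv_fderiv hG hb hnull,
    hb (fderiv ℝ G' (j y) _) (secondDeriv G' _ _ _), add_zero]

/-- Two diagonal isotropic maps on `ℝ^m`, `m ≥ 2`, cannot be glued along the inversion in the unit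
sphere when the conformal factor decays like `|y|⁻⁴`: the potential of a principal field would be
a function without critical points whose differential is `O(|y|⁻²)`. -/
theorem IsDiagonalIsotropic.false_of_inversion (hm : 2 ≤ m) (H : IsDiagonalIsotropic b h G σ)
    (H' : IsDiagonalIsotropic b h G' σ') (hglue : ∀ y, y ≠ 0 → G y = G' ((‖y‖ ^ 2)⁻¹ • y))
    {C₀ : ℝ} (hdecay : ∀ y, σ y ≤ C₀ / (1 + ‖y‖ ^ 2) ^ 2) : False := by
  obtain ⟨C₁, hC₁⟩ := H.exists_bound_closedBall
  obtain ⟨C₂, hC₂⟩ := H'.exists_bound_closedBall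
  obtain ⟨C, hC0, hC1, hC2⟩ : ∃ C, 0 ≤ C ∧ C₁ ≤ C ∧ C₂ ≤ C :=
    ⟨max 0 (max C₁ C₂), le_max_left _ _, (le_max_left _ _).trans (le_max_right _ _),
      (le_max_right _ _).trans (le_max_right _ _)⟩
  have hbound (y X : D) : - b (secondDeriv G y X X) (secondDeriv G y X X)
      ≤ C * h (fderiv ℝ G y X) (fderiv ℝ G y X) ^ 2 := by
    rcases le_or_gt ‖y‖ 1 with hy | hy
    · refine (hC₁ y (mem_closedBall_zero_iff.2 hy) X).trans ?_
      gcongr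
    -- both sides of the bound are invariant under the inversion, which maps `y` into the unit ball
    · have hy0 : y ≠ 0 := norm_pos_iff.1 (one_pos.trans hy)
      set j : D → D := fun y => (‖y‖ ^ 2)⁻¹ • y with hjdef
      have hj : ContDiffAt ℝ ∞ j y :=
        ((contDiff_norm_sq ℝ).contDiffAt.inv (pow_ne_zero 2 (norm_ne_zero_iff.2 hy0))).smul
          contDiffAt_id
      have hGj : G =ᶠ[𝓝 y] G' ∘ j := by
        filter_upwards [isOpen_ne.mem_nhds hy0] with z hz
        exact hglue z hz
      obtain ⟨h1, h2⟩ := secondDeriv_comp_sq H'.contDiff H'.symm H'.isotropic hj hGj X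
      rw [h1, h2 ((H.contDiff.fderiv_right (m := ∞) (by simp)).differentiable (by simp) y)]
      have hjy : j y ∈ closedBall (0 : D) 1 := by
        rw [mem_closedBall_zero_iff, hjdef]
        simp only
        rw [norm_smul, norm_inv, norm_pow, norm_norm, inv_mul_le_iff₀ (by positivity)]
        nlinarith
      refine (hC₂ (j y) hjy _).trans ?_
      gcongr
  obtain ⟨u, Z, hZ0, hu, hQ⟩ := H.exists_potential (by omega)
  have hC₀ : 0 < C₀ := by simpa using (H.factor_pos 0).trans_le (hdecay 0)
  have hdec (y : D) : ‖fderiv ℝ u y‖ ≤ Real.sqrt (C * C₀) / (1 + ‖y‖ ^ 2) := by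
    have hZ : 0 < ‖Z y‖ := norm_pos_iff.2 (hZ0 y)
    have hσ := H.factor_pos y
    rw [(hu y).fderiv, norm_smul, norm_inv, norm_pow, norm_norm, innerSL_apply_norm]
    have h1 : (‖Z y‖ ^ 2)⁻¹ * ‖Z y‖ = ‖Z y‖⁻¹ := by field_simp
    rw [h1]
    have h2 := hbound y (Z y)
    rw [hQ, neg_neg, H.conformal, real_inner_self_eq_norm_sq] at h2
    have h3 : 1 ≤ C * σ y * ‖Z y‖ ^ 2 := by
      have h4 : 0 < σ y * ‖Z y‖ ^ 2 := by positivity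
      nlinarith
    have h4 : 1 ≤ C * (C₀ / (1 + ‖y‖ ^ 2) ^ 2) * ‖Z y‖ ^ 2 := by
      refine h3.trans ?_
      have := hdecay y
      gcongr
    have h5 : ‖Z y‖⁻¹ ^ 2 ≤ C * C₀ / (1 + ‖y‖ ^ 2) ^ 2 := by
      rw [inv_pow, inv_le_iff_one_le_mul₀ (by positivity), mul_div_assoc]
      linarith
    rw [le_div_iff₀ (by positivity)]
    refine Real.le_sqrt_of_sq_le ?_
    rw [mul_pow]
    rwa [le_div_iff₀ (by positivity)] at h5
  obtain ⟨y, hy⟩ := exists_fderiv_eq_zero (by rwa [finrank_euclideanSpace_fin])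
    (fun y => (hu y).differentiableAt) hdec
  rw [(hu y).fderiv] at hy
  have h1 := congrArg (fun T : D →L[ℝ] ℝ => T (Z y)) hy
  simp only [smul_apply, innerSL_apply_apply, real_inner_self_eq_norm_sq, smul_eq_mul,
    zero_apply] at h1
  have hZ : ‖Z y‖ ≠ 0 := norm_ne_zero_iff.2 (hZ0 y)
  exact (mul_ne_zero (inv_ne_zero (pow_ne_zero 2 hZ)) (pow_ne_zero 2 hZ)) h1

end Inversion

/-! ### Stereographic coordinates -/

section Stereographic

open Module

variable {E F : Type*} [NormedAddCommGroup E] [InnerProductSpace ℝ E]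
  [NormedAddCommGroup F] [InnerProductSpace ℝ F]

/-- The conformal factor `2 / (1 + |y|²)` of the inverse stereographic projection. -/
def stereoFactor {E : Type*} [NormedAddCommGroup E] (y : E) : ℝ := 2 * (1 + ‖y‖ ^ 2)⁻¹

/-- The inverse of the stereographic projection of the unit sphere of `F` from the pole `v` onto
the hyperplane `j(E)`, which should be orthogonal to `v`. -/
def stereoInverse (j : E →ₗᵢ[ℝ] F) (v : F) (y : E) : F :=
  stereoFactor y • j y + (1 - stereoFactor y) • v

theorem stereoFactor_pos {E : Type*} [NormedAddCommGroup E] (y : E) : 0 < stereoFactor y := by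
  unfold stereoFactor; positivity

theorem stereoFactor_mul {E : Type*} [NormedAddCommGroup E] (y : E) :
    stereoFactor y * (1 + ‖y‖ ^ 2) = 2 := by
  unfold stereoFactor; field_simp

theorem contDiff_stereoFactor : ContDiff ℝ ∞ (stereoFactor (E := E)) :=
  contDiff_const.mul ((contDiff_const.add (contDiff_norm_sq ℝ)).inv fun y => by positivity)

theorem hasFDerivAt_stereoFactor (y : E) :
    HasFDerivAt stereoFactor (-(stereoFactor y ^ 2) • innerSL ℝ y) y := by
  have h1 : HasFDerivAt (fun y : E => 1 + ‖y‖ ^ 2) (2 • innerSL ℝ y) y :=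
    (hasStrictFDerivAt_norm_sq y).hasFDerivAt.const_add 1
  have h2 :=
    ((hasDerivAt_inv (by positivity : 1 + ‖y‖ ^ 2 ≠ 0)).comp_hasFDerivAt y h1).const_mul 2
  refine h2.congr_fderiv ?_
  ext X
  simp [stereoFactor, ← inv_pow]
  ring

variable {j : E →ₗᵢ[ℝ] F} {v : F}

theorem contDiff_stereoInverse : ContDiff ℝ ∞ (stereoInverse j v) :=
  (contDiff_stereoFactor.smul j.contDiff).add
    ((contDiff_const.sub contDiff_stereoFactor).smul contDiff_const)

theorem norm_stereoInverse (hv : ‖v‖ = 1) (hj : ∀ y, inner ℝ (j y) v = 0) (y : E) :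
    ‖stereoInverse j v y‖ = 1 := by
  have h1 : ‖stereoInverse j v y‖ ^ 2 = 1 := by
    rw [stereoInverse, norm_add_sq_real, norm_smul, norm_smul, j.norm_map, hv,
      real_inner_smul_left, real_inner_smul_right, hj, mul_pow, mul_pow, Real.norm_eq_abs, sq_abs,
      Real.norm_eq_abs, sq_abs]
    linear_combination stereoFactor y * stereoFactor_mul y
  nlinarith [norm_nonneg (stereoInverse j v y)]

theorem inner_fderiv_stereoInverse (hv : ‖v‖ = 1) (hj : ∀ y, inner ℝ (j y) v = 0) (y X Y : E) :
    inner ℝ (fderiv ℝ (stereoInverse j v) y X) (fderiv ℝ (stereoInverse j v) y Y)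
      = stereoFactor y ^ 2 * inner ℝ X Y := by
  have hd (X : E) : fderiv ℝ (stereoInverse j v) y X
      = stereoFactor y • j X - (stereoFactor y ^ 2 * inner ℝ y X) • (j y - v) := by
    have h1 := ((hasFDerivAt_stereoFactor y).smul j.toContinuousLinearMap.hasFDerivAt).add
      (((hasFDerivAt_stereoFactor y).const_sub 1).smul (hasFDerivAt_const v y))
    have h2 : HasFDerivAt (stereoInverse j v) _ y := h1
    rw [h2.fderiv]
    simp
    module
  have hj' (y : E) : inner ℝ v (j y) = 0 := by rw [real_inner_comm, hj]
  have hvv : inner ℝ v v = (1 : ℝ) := by rw [real_inner_self_eq_norm_sq, hv, one_pow]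
  rw [hd, hd]
  simp only [inner_sub_left, inner_sub_right, real_inner_smul_left, real_inner_smul_right,
    j.inner_map_map, hj, hj', hvv, real_inner_self_eq_norm_sq, real_inner_comm X y]
  linear_combination stereoFactor y ^ 3 * inner ℝ X y * inner ℝ y Y * stereoFactor_mul y

/-- The stereographic projections from opposite poles differ by the inversion in the unit
sphere. -/
theorem stereoInverse_inversion {y : E} (hy : y ≠ 0) :
    stereoInverse j (-v) ((‖y‖ ^ 2)⁻¹ • y) = stereoInverse j v y := by
  have hn : 0 < ‖y‖ := norm_pos_iff.2 hy
  have h1 : stereoFactor ((‖y‖ ^ 2)⁻¹ • y) = stereoFactor y * ‖y‖ ^ 2 := by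
    rw [stereoFactor, stereoFactor, norm_smul, norm_inv, norm_pow, norm_norm]
    field_simp
    ring
  have h2 : 1 - stereoFactor y * ‖y‖ ^ 2 = -(1 - stereoFactor y) := by
    linear_combination - stereoFactor_mul y
  rw [stereoInverse, stereoInverse, h1, h2, map_smul, smul_smul, mul_assoc,
    mul_inv_cancel₀ (by positivity), mul_one, smul_neg, neg_smul, neg_neg]

end Stereographic

/-! ### Lifting an isometric immersion of a sphere to an isotropic map -/

section SphereLift

open Module

variable {V E : Type*} [NormedAddCommGroup V] [NormedSpace ℝ V]
  [NormedAddCommGroup E] [InnerProductSpace ℝ E]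

/-- The semidefinite scalar product on the product of a vector space and a Euclidean space that
comes from the second factor. -/
def sndForm (V E : Type*) [NormedAddCommGroup V] [NormedSpace ℝ V]
    [NormedAddCommGroup E] [InnerProductSpace ℝ E] : V × E →L[ℝ] V × E →L[ℝ] ℝ :=
  (innerSL ℝ : E →L[ℝ] E →L[ℝ] ℝ).bilinearComp (ContinuousLinearMap.snd ℝ V E)
    (ContinuousLinearMap.snd ℝ V E)

/-- The scalar product `β - ⟨·, ·⟩` on the product of a scalar product space and a Euclidean
space. -/
def differenceForm (β : V →L[ℝ] V →L[ℝ] ℝ) : V × E →L[ℝ] V × E →L[ℝ] ℝ :=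
  β.bilinearComp (ContinuousLinearMap.fst ℝ V E) (ContinuousLinearMap.fst ℝ V E) - sndForm V E

@[simp]
theorem sndForm_apply (p q : V × E) : sndForm V E p q = inner ℝ p.2 q.2 := by
  simp [sndForm]

@[simp]
theorem differenceForm_apply (β : V →L[ℝ] V →L[ℝ] ℝ) (p q : V × E) :
    differenceForm β p q = β p.1 q.1 - inner ℝ p.2 q.2 := by
  simp [differenceForm]

/-- `pseudoForm` as a continuous bilinear map. -/
def pseudoFormL (N s : ℕ) : (Fin N → ℝ) →L[ℝ] (Fin N → ℝ) →L[ℝ] ℝ :=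
  LinearMap.toContinuousLinearMap
    ((LinearMap.toContinuousLinearMap (𝕜 := ℝ) (E := Fin N → ℝ) (F' := ℝ)).toLinearMap ∘ₗ
      pseudoForm N s)

theorem pseudoFormL_apply (N s : ℕ) (v w : Fin N → ℝ) : pseudoFormL N s v w = pseudoForm N s v w :=
  rfl

/-- The positive index of `differenceForm` is that of `ℝ^N_s`: the last `N - s` coordinates of
`ℝ^N` are injective on a nonnegative subspace. -/
theorem finrank_le_of_differenceForm_nonneg [FiniteDimensional ℝ E] {N s : ℕ}
    (P : Submodule ℝ ((Fin N → ℝ) × E)) (hP : ∀ p ∈ P, 0 ≤ differenceForm (pseudoFormL N s) p p) :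
    finrank ℝ P ≤ N - s := by
  let π : P →ₗ[ℝ] (Fin (N - s) → ℝ) :=
    (LinearMap.funLeft ℝ ℝ fun i : Fin (N - s) => (⟨s + i.val, by omega⟩ : Fin N)) ∘ₗ
      (LinearMap.fst ℝ (Fin N → ℝ) E) ∘ₗ P.subtype
  have hπ : Function.Injective π := by
    rw [← LinearMap.ker_eq_bot, LinearMap.ker_eq_bot']
    rintro ⟨⟨v, a⟩, hp⟩ hz
    have hz' (i : Fin N) (hi : ¬ i.val < s) : v i = 0 := by
      have h1 := congrFun hz (⟨i.val - s, by omega⟩ : Fin (N - s))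
      have h2 : v ⟨s + (i.val - s), by omega⟩ = 0 := h1
      convert h2 using 2
      ext
      simp only
      omega
    have h0 := hP _ hp
    rw [differenceForm_apply, pseudoFormL_apply, pseudoForm_apply, real_inner_self_eq_norm_sq] at h0
    have h1 : ∑ i : Fin N, (if i.val < s then (-1 : ℝ) else 1) * v i * v i = - ∑ i, v i ^ 2 := by
      rw [← Finset.sum_neg_distrib]
      refine Finset.sum_congr rfl fun i _ => ?_
      split_ifs with hi
      · ring
      · rw [hz' i hi]; ring
    simp only at h0
    rw [h1] at h0
    have h2 : 0 ≤ ∑ i, v i ^ 2 := Finset.sum_nonneg fun i _ => sq_nonneg _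
    have h3 : ∑ i, v i ^ 2 = 0 := by nlinarith [sq_nonneg ‖a‖]
    have h4 : ‖a‖ ^ 2 = 0 := by nlinarith [sq_nonneg ‖a‖]
    have h5 : v = 0 := by
      funext i
      exact pow_eq_zero_iff two_ne_zero |>.1
        ((Finset.sum_eq_zero_iff_of_nonneg fun i _ => sq_nonneg (v i)).1 h3 i (Finset.mem_univ i))
    have h6 : a = 0 := by simpa using h4
    ext1
    simp [h5, h6]
  have := LinearMap.finrank_le_finrank_of_injective hπ
  rwa [finrank_fin_fun] at this

theorem eq_zero_of_differenceForm {N s : ℕ} (w : (Fin N → ℝ) × E)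
    (hw : ∀ v, differenceForm (pseudoFormL N s) w v = 0) : w = 0 := by
  ext i
  · have h1 := hw (Pi.single i 1, 0)
    rw [differenceForm_apply, pseudoFormL_apply, pseudoForm_apply] at h1
    simp only [Pi.single_apply, mul_ite, mul_one, mul_zero, Finset.sum_ite_eq', Finset.mem_univ,
      if_true, inner_zero_right, sub_zero] at h1
    split_ifs at h1 <;> simpa using h1
  · have h1 := hw (0, w.2)
    simpa using h1

variable {m : ℕ}

local notation "D" => EuclideanSpace ℝ (Fin m)

/-- A map `F` into a quadric which is isometric for `R²` times the metric of a conformal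
parametrization `φ` of the unit sphere gives the isotropic map `(F, R φ)`. -/
theorem isDiagonalIsotropic_prodMk [FiniteDimensional ℝ E] (hE : finrank ℝ E = m + 1)
    {N s : ℕ} (hN : N = 2 * m) {F : D → Fin N → ℝ} {φ : D → E} {ρ : D → ℝ} {R c : ℝ}
    (hF : ContDiff ℝ ∞ F) (hφ : ContDiff ℝ ∞ φ) (hρ : ContDiff ℝ ∞ ρ) (hρ0 : ∀ y, 0 < ρ y)
    (hφ1 : ∀ y, ‖φ y‖ = 1)
    (hconf : ∀ y X Y, inner ℝ (fderiv ℝ φ y X) (fderiv ℝ φ y Y) = ρ y ^ 2 * inner ℝ X Y)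
    (hR : 0 < R) (hFc : ∀ y, pseudoForm N s (F y) (F y) = c)
    (hiso : ∀ y X Y, pseudoForm N s (fderiv ℝ F y X) (fderiv ℝ F y Y)
      = R ^ 2 * inner ℝ (fderiv ℝ φ y X) (fderiv ℝ φ y Y))
    (hs : N - s ≤ m ∧ c < 0 ∨ N - s ≤ m + 1 ∧ R ^ 2 < c) :
    IsDiagonalIsotropic (differenceForm (pseudoFormL N s)) (sndForm (Fin N → ℝ) E)
      (fun y => (F y, R • φ y)) fun y => R ^ 2 * ρ y ^ 2 := by
  have dF : Differentiable ℝ F := hF.differentiable (by simp)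
  have dφ : Differentiable ℝ φ := hφ.differentiable (by simp)
  have hRφ : ContDiff ℝ ∞ fun y => R • φ y := contDiff_const.smul hφ
  have hd (y X : D) : fderiv ℝ (fun y => (F y, R • φ y)) y X
      = (fderiv ℝ F y X, R • fderiv ℝ φ y X) := by
    have h1 : HasFDerivAt (fun y => (F y, R • φ y)) ((fderiv ℝ F y).prod (R • fderiv ℝ φ y)) y :=
      (dF y).hasFDerivAt.prodMk ((dφ y).hasFDerivAt.const_smul R)
    rw [h1.fderiv]
    rfl
  have hφφ (y X : D) : inner ℝ (fderiv ℝ φ y X) (φ y) = 0 := by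
    have h1 := fderiv_inner_apply ℝ (dφ y) (dφ y) X
    simp only [real_inner_self_eq_norm_sq, hφ1] at h1
    rw [fderiv_fun_const, Pi.zero_apply, zero_apply, real_inner_comm] at h1
    linarith
  refine isDiagonalIsotropic_of_signature (κ := c - R ^ 2) (ν := fun y => (0, R • φ y))
    (q := N - s) (hF.prodMk hRφ) (fun v w => ?_)
    (fun v w => ?_) (fun y X Y => ?_) (fun y X Y => ?_) (contDiff_const.mul (hρ.pow 2))
    (fun y => by have := hρ0 y; positivity) ?_ (fun y => ?_)
    (contDiff_const.prodMk hRφ) (fun y X => ?_) (fun y X Y => ?_) eq_zero_of_differenceForm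
    ?_ finrank_le_of_differenceForm_nonneg ?_
  · rw [differenceForm_apply, differenceForm_apply, pseudoFormL_apply, pseudoFormL_apply,
      pseudoForm_comm, real_inner_comm]
  · rw [sndForm_apply, sndForm_apply, real_inner_comm]
  · rw [hd, hd, differenceForm_apply, pseudoFormL_apply, hiso]
    simp only [real_inner_smul_left, real_inner_smul_right]
    ring
  · rw [hd, hd, sndForm_apply]
    simp only [real_inner_smul_left, real_inner_smul_right, hconf]
    ring
  · rcases hs with hs | hs
    · have := sq_nonneg R
      exact (by linarith : c - R ^ 2 < 0).ne
    · exact (sub_pos.2 hs.2).ne'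
  · rw [differenceForm_apply, pseudoFormL_apply, hFc]
    rw [real_inner_self_eq_norm_sq, norm_smul, hφ1, Real.norm_eq_abs, mul_one, sq_abs]
  · rw [hd, differenceForm_apply]
    simp [real_inner_smul_left, real_inner_smul_right, hφφ]
  · have h1 : fderiv ℝ (fun y => ((0 : Fin N → ℝ), R • φ y)) y Y = (0, R • fderiv ℝ φ y Y) := by
      have h2 : HasFDerivAt (fun y => ((0 : Fin N → ℝ), R • φ y))
          ((0 : D →L[ℝ] Fin N → ℝ).prod (R • fderiv ℝ φ y)) y :=
        (hasFDerivAt_const (0 : Fin N → ℝ) y).prodMk ((dφ y).hasFDerivAt.const_smul R)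
      rw [h2.fderiv]
      rfl
    rw [hd, h1, differenceForm_apply]
    simp only [real_inner_smul_left, real_inner_smul_right, hconf, map_zero]
    ring
  · rw [finrank_prod, finrank_fin_fun, hE]
    omega
  · rcases hs with hs | hs
    · exact Or.inl hs.1
    · exact Or.inr ⟨hs.1, sub_pos.2 hs.2⟩

end SphereLift

/-! ### Pulling back to parametrizations of the sphere -/

section Pullback

open Metric

variable {m N : ℕ} {f : SphereManifold m → (Fin N → ℝ)}
  {B : LinearMap.BilinForm ℝ (Fin N → ℝ)} {Q : Set (Fin N → ℝ)} {R : ℝ}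
  {T : Type*} [NormedAddCommGroup T] [NormedSpace ℝ T]

/-- An isometric immersion of `S^m(R)` multiplies the scalar products of the velocities of a map
`φ` into the unit sphere by `R²`. -/
theorem IsIsometricImmersion.comp_sphere (hf : IsIsometricImmersion (sphereMetric m R) B Q f)
    {φ : T → EuclideanSpace ℝ (Fin (m + 1))} (hφ : ContDiff ℝ ∞ φ)
    (hφ1 : ∀ y, φ y ∈ sphere (0 : EuclideanSpace ℝ (Fin (m + 1))) 1) :
    ContDiff ℝ ∞ (fun y => f ⟨φ y, hφ1 y⟩) ∧
    ∀ y X Y, B (fderiv ℝ (fun y => f ⟨φ y, hφ1 y⟩) y X) (fderiv ℝ (fun y => f ⟨φ y, hφ1 y⟩) y Y)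
      = R ^ 2 * inner ℝ (fderiv ℝ φ y X) (fderiv ℝ φ y Y) := by
  let : Fact (Module.finrank ℝ (EuclideanSpace ℝ (Fin (m + 1))) = m + 1) :=
    ⟨finrank_euclideanSpace_fin⟩
  let ψ : T → SphereManifold m := fun y => ⟨φ y, hφ1 y⟩
  have hψ : ContMDiff 𝓘(ℝ, T) (𝓡 m) ∞ ψ :=
    ContMDiff.codRestrict_sphere (contMDiff_iff_contDiff.2 hφ) hφ1
  have dψ : MDifferentiable 𝓘(ℝ, T) (𝓡 m) ψ := hψ.mdifferentiable (by simp)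
  have hfs : ContMDiff (𝓡 m) 𝓘(ℝ, Fin N → ℝ) ∞ f := hf.contMDiff
  have df : MDifferentiable (𝓡 m) 𝓘(ℝ, Fin N → ℝ) f := hfs.mdifferentiable (by simp)
  refine ⟨contMDiff_iff_contDiff.1 (hfs.comp hψ), fun y X Y => ?_⟩
  have h1 (X : T) : fderiv ℝ (fun y => f ⟨φ y, hφ1 y⟩) y X
      = ambientDeriv f (ψ y) (mfderiv 𝓘(ℝ, T) (𝓡 m) ψ y X) := by
    have h2 := mfderiv_comp y (df (ψ y)) (dψ y)
    rw [mfderiv_eq_fderiv] at h2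
    exact congrArg (fun L : T →L[ℝ] (Fin N → ℝ) => L X) h2
  have hcoe : ContMDiff (𝓡 m) 𝓘(ℝ, EuclideanSpace ℝ (Fin (m + 1))) ∞ (sphereEmbedding m R) :=
    (contDiff_const_smul R).contMDiff.comp contMDiff_coe_sphere
  have h3 (X : T) : sphereEmbeddingDeriv m R (ψ y) (mfderiv 𝓘(ℝ, T) (𝓡 m) ψ y X)
      = R • fderiv ℝ φ y X := by
    have h2 := mfderiv_comp y (hcoe.mdifferentiable (by simp) (ψ y)) (dψ y)
    rw [mfderiv_eq_fderiv] at h2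
    have h4 : fderiv ℝ (sphereEmbedding m R ∘ ψ) y = R • fderiv ℝ φ y :=
      ((hφ.differentiable (by simp) y).hasFDerivAt.const_smul R).fderiv
    rw [h4] at h2
    exact (congrArg (fun L : T →L[ℝ] EuclideanSpace ℝ (Fin (m + 1)) => L X) h2).symm
  rw [h1, h1, hf.isometric, sphereMetric, h3, h3, real_inner_smul_left, real_inner_smul_right]
  ring

end Pullback

/-! ### Spheres of dimension at least two -/

section HigherDimension

open Module Metric

theorem exists_linearIsometry_inner_eq_zero (m : ℕ) :
    ∃ (j : EuclideanSpace ℝ (Fin m) →ₗᵢ[ℝ] EuclideanSpace ℝ (Fin (m + 1)))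
      (v : EuclideanSpace ℝ (Fin (m + 1))), ‖v‖ = 1 ∧ ∀ y, inner ℝ (j y) v = 0 := by
  let : Fact (finrank ℝ (EuclideanSpace ℝ (Fin (m + 1))) = m + 1) := ⟨finrank_euclideanSpace_fin⟩
  let v : EuclideanSpace ℝ (Fin (m + 1)) := EuclideanSpace.single 0 1
  have hv : ‖v‖ = 1 := by simp [v]
  have hv0 : v ≠ 0 := fun h => by simp [h] at hv
  refine ⟨(ℝ ∙ v)ᗮ.subtypeₗᵢ.comp
    (OrthonormalBasis.fromOrthogonalSpanSingleton m hv0).repr.symm.toLinearIsometry, v, hv,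
    fun y => ?_⟩
  rw [real_inner_comm]
  exact Submodule.mem_orthogonal_singleton_iff_inner_right.1 (Subtype.property _)

/-- The isotropic lift of an isometric immersion of a sphere in a stereographic chart. -/
theorem IsIsometricImmersion.isDiagonalIsotropic_stereoInverse {m N s : ℕ} (hN : N = 2 * m)
    {Q : Set (Fin N → ℝ)} {R c : ℝ} (hR : 0 < R) (hQ : ∀ x ∈ Q, pseudoForm N s x x = c)
    (hs : N - s ≤ m ∧ c < 0 ∨ N - s ≤ m + 1 ∧ R ^ 2 < c) {f : SphereManifold m → (Fin N → ℝ)}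
    (hf : IsIsometricImmersion (sphereMetric m R) (pseudoForm N s) Q f)
    {j : EuclideanSpace ℝ (Fin m) →ₗᵢ[ℝ] EuclideanSpace ℝ (Fin (m + 1))}
    {v : EuclideanSpace ℝ (Fin (m + 1))} (hv : ‖v‖ = 1) (hj : ∀ y, inner ℝ (j y) v = 0)
    (hφ : ∀ y, stereoInverse j v y ∈ sphere (0 : EuclideanSpace ℝ (Fin (m + 1))) 1) :
    IsDiagonalIsotropic (differenceForm (pseudoFormL N s))
      (sndForm (Fin N → ℝ) (EuclideanSpace ℝ (Fin (m + 1))))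
      (fun y => (f ⟨stereoInverse j v y, hφ y⟩, R • stereoInverse j v y))
      fun y => R ^ 2 * stereoFactor y ^ 2 := by
  obtain ⟨hF, hiso⟩ := hf.comp_sphere contDiff_stereoInverse hφ
  exact isDiagonalIsotropic_prodMk finrank_euclideanSpace_fin hN hF contDiff_stereoInverse
    contDiff_stereoFactor stereoFactor_pos (norm_stereoInverse hv hj)
    (inner_fderiv_stereoInverse hv hj) hR (fun y => hQ _ (hf.mem _)) hiso hs

theorem IsIsometricImmersion.false_of_two_le {m : ℕ} (hm : 2 ≤ m) {N s : ℕ} (hN : N = 2 * m)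
    {Q : Set (Fin N → ℝ)} {R c : ℝ} (hR : 0 < R) (hQ : ∀ x ∈ Q, pseudoForm N s x x = c)
    (hs : N - s ≤ m ∧ c < 0 ∨ N - s ≤ m + 1 ∧ R ^ 2 < c) {f : SphereManifold m → (Fin N → ℝ)}
    (hf : IsIsometricImmersion (sphereMetric m R) (pseudoForm N s) Q f) : False := by
  obtain ⟨j, v, hv, hj⟩ := exists_linearIsometry_inner_eq_zero m
  have hv' : ‖-v‖ = 1 := by rw [norm_neg, hv]
  have hj' (y) : inner ℝ (j y) (-v) = 0 := by rw [inner_neg_right, hj, neg_zero]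
  have hφ (y) := mem_sphere_zero_iff_norm.2 (norm_stereoInverse hv hj y)
  have hφ' (y) := mem_sphere_zero_iff_norm.2 (norm_stereoInverse hv' hj' y)
  refine (hf.isDiagonalIsotropic_stereoInverse hN hR hQ hs hv hj hφ).false_of_inversion hm
    (hf.isDiagonalIsotropic_stereoInverse hN hR hQ hs hv' hj' hφ') (fun y hy => ?_)
    (C₀ := 4 * R ^ 2) (fun y => ?_)
  · simp only [stereoInverse_inversion hy]
  · rw [stereoFactor, mul_pow, inv_pow, div_eq_mul_inv]
    exact le_of_eq (by ring)

end HigherDimension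

/-! ### The circle -/

section Circle

open Metric Real

variable {N : ℕ} {f : SphereManifold 1 → (Fin N → ℝ)}
  {B : LinearMap.BilinForm ℝ (Fin N → ℝ)} {Q : Set (Fin N → ℝ)} {R : ℝ}

theorem IsIsometricImmersion.exists_periodic_curve
    (hf : IsIsometricImmersion (sphereMetric 1 R) B Q f) :
    ∃ γ : ℝ → (Fin N → ℝ), ContDiff ℝ ∞ γ ∧ Function.Periodic γ (2 * π) ∧ (∀ t, γ t ∈ Q) ∧
      ∀ t, B (deriv γ t) (deriv γ t) = R ^ 2 := by
  let φ : ℝ → EuclideanSpace ℝ (Fin (1 + 1)) := fun t => !₂[cos t, sin t]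
  have hφ : ContDiff ℝ ∞ φ := by
    rw [contDiff_euclidean]
    intro i
    fin_cases i
    · exact Real.contDiff_cos
    · exact Real.contDiff_sin
  have hφ1 (t : ℝ) : φ t ∈ sphere (0 : EuclideanSpace ℝ (Fin (1 + 1))) 1 := by
    rw [mem_sphere_zero_iff_norm, EuclideanSpace.norm_eq]
    simp [φ]
  obtain ⟨h1, h2⟩ := hf.comp_sphere hφ hφ1
  refine ⟨_, h1, fun t => ?_, fun t => hf.mem _, fun t => ?_⟩
  · have : φ (t + 2 * π) = φ t := by simp [φ]
    simp only [this]
  · have h3 := h2 t 1 1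
    have h4 : HasFDerivAt φ (ContinuousLinearMap.toSpanSingleton ℝ
        (!₂[-sin t, cos t] : EuclideanSpace ℝ (Fin (1 + 1)))) t := by
      have h5 : HasDerivAt (fun t => ![cos t, sin t]) ![-sin t, cos t] t := by
        rw [hasDerivAt_pi]
        intro i
        fin_cases i
        · exact hasDerivAt_cos t
        · exact hasDerivAt_sin t
      have : HasDerivAt φ (!₂[-sin t, cos t] : EuclideanSpace ℝ (Fin (1 + 1))) t :=
        (PiLp.continuousLinearEquiv 2 ℝ fun _ : Fin 2 =>
          ℝ).symm.toContinuousLinearMap.hasFDerivAt.comp_hasDerivAt t h5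
      exact this.hasFDerivAt
    have h5 : inner ℝ (fderiv ℝ φ t 1) (fderiv ℝ φ t 1) = (1 : ℝ) := by
      rw [h4.fderiv, real_inner_self_eq_norm_sq, EuclideanSpace.norm_eq, sq_sqrt (by positivity)]
      simp
    rw [h5, mul_one] at h3
    exact h3

/-- A spacelike curve on the hyperbola `-x² + z² = -1` does not close up: where `z` is maximal its
velocity would vanish. -/
theorem not_exists_periodic_curve_hyperbola {x z : ℝ → ℝ} (hx : Differentiable ℝ x)
    (hz : Differentiable ℝ z) {T : ℝ} (hT : 0 < T) (hper : Function.Periodic z T)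
    (hxz : ∀ t, -(x t) ^ 2 + z t ^ 2 = -1) (hR : ∀ t, 0 < -(deriv x t) ^ 2 + deriv z t ^ 2) :
    False := by
  obtain ⟨t, -, ht⟩ := (isCompact_Icc (a := 0) (b := T)).exists_isMaxOn
    (Set.nonempty_Icc.2 hT.le) hz.continuous.continuousOn
  have hmax : IsLocalMax z t := Filter.Eventually.of_forall fun r => by
    obtain ⟨r', hr', h⟩ := hper.exists_mem_Ico₀ hT r
    rw [h]
    exact ht (Set.Ico_subset_Icc_self hr')
  have hz' := hmax.deriv_eq_zero
  have h1 : HasDerivAt (fun t => -(x t) ^ 2 + z t ^ 2)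
      (-(2 * x t * deriv x t) + 2 * z t * deriv z t) t := by
    have h2 := ((hx t).hasDerivAt.pow 2).neg.add ((hz t).hasDerivAt.pow 2)
    refine (h2.congr_deriv ?_)
    simp
  have h2 : HasDerivAt (fun t => -(x t) ^ 2 + z t ^ 2) 0 t := by
    rw [funext hxz]
    exact hasDerivAt_const t _
  have h3 := h1.unique h2
  have h4 := hR t
  rw [hz'] at h3 h4
  have h5 : x t * deriv x t = 0 := by linarith
  have h6 : x t ≠ 0 := fun h => by nlinarith [hxz t, sq_nonneg (z t)]
  have h7 := (mul_eq_zero.1 h5).resolve_left h6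
  rw [h7] at h4
  norm_num at h4

/-- A curve of constant speed `R` on the unit circle rotates by the angle `2πR` in time `2π`, so
that `R` is an integer if the curve closes up. -/
theorem not_exists_periodic_curve_circle {x z : ℝ → ℝ} (hx : ContDiff ℝ 1 x) (hz : ContDiff ℝ 1 z)
    (hpx : Function.Periodic x (2 * π)) (hpz : Function.Periodic z (2 * π))
    (hxz : ∀ t, x t ^ 2 + z t ^ 2 = 1) (hR0 : 0 < R) (hR1 : R < 1)
    (hR : ∀ t, deriv x t ^ 2 + deriv z t ^ 2 = R ^ 2) : False := by
  have dx : Differentiable ℝ x := hx.differentiable (by simp)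
  have dz : Differentiable ℝ z := hz.differentiable (by simp)
  have hxx (t : ℝ) : x t * deriv x t + z t * deriv z t = 0 := by
    have h1 : HasDerivAt (fun t => x t ^ 2 + z t ^ 2)
        (2 * x t * deriv x t + 2 * z t * deriv z t) t := by
      refine (((dx t).hasDerivAt.pow 2).add ((dz t).hasDerivAt.pow 2)).congr_deriv ?_
      simp
    have h2 : HasDerivAt (fun t => x t ^ 2 + z t ^ 2) 0 t := by
      rw [funext hxz]
      exact hasDerivAt_const t _
    linarith [h1.unique h2]
  obtain ⟨θ, hθ, hθR⟩ : ∃ θ, (∀ t, x t * deriv z t - z t * deriv x t = θ) ∧ (θ = R ∨ θ = -R) := by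
    have hc : Continuous fun t => x t * deriv z t - z t * deriv x t :=
      (hx.continuous.mul (hz.continuous_deriv le_rfl)).sub
        (hz.continuous.mul (hx.continuous_deriv le_rfl))
    have hsq (t : ℝ) : (x t * deriv z t - z t * deriv x t) ^ 2 = R ^ 2 := by
      rw [← hR t]
      linear_combination (deriv x t ^ 2 + deriv z t ^ 2) * hxz t
        - (x t * deriv x t + z t * deriv z t) * hxx t
    rcases isPreconnected_univ.eq_or_eq_neg_of_sq_eq hc.continuousOn continuousOn_const
      (fun t _ => hsq t) (fun _ => hR0.ne') with h | h
    · exact ⟨R, fun t => h (Set.mem_univ t), Or.inl rfl⟩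
    · exact ⟨-R, fun t => h (Set.mem_univ t), Or.inr rfl⟩
  have hx' (t : ℝ) : deriv x t = -(θ * z t) := by
    rw [← hθ t]; linear_combination x t * hxx t - deriv x t * hxz t
  have hz' (t : ℝ) : deriv z t = θ * x t := by
    rw [← hθ t]; linear_combination z t * hxx t - deriv z t * hxz t
  have dcos (t : ℝ) : HasDerivAt (fun t => cos (θ * t)) (-sin (θ * t) * θ) t := by
    simpa using ((hasDerivAt_id t).const_mul θ).cos
  have dsin (t : ℝ) : HasDerivAt (fun t => sin (θ * t)) (cos (θ * t) * θ) t := by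
    simpa using ((hasDerivAt_id t).const_mul θ).sin
  -- the coordinates in the frame that rotates with angular velocity `θ` are constant
  have h1 : ∀ t, x t * cos (θ * t) + z t * sin (θ * t) = x 0 := by
    have hd (t : ℝ) : HasDerivAt (fun t => x t * cos (θ * t) + z t * sin (θ * t)) 0 t := by
      refine (((dx t).hasDerivAt.mul (dcos t)).add
        ((dz t).hasDerivAt.mul (dsin t))).congr_deriv ?_
      rw [hx', hz']; ring
    intro t
    have := is_const_of_deriv_eq_zero (fun t => (hd t).differentiableAt) (fun t => (hd t).deriv) t 0
    simpa using this
  have h2 : ∀ t, z t * cos (θ * t) - x t * sin (θ * t) = z 0 := by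
    have hd (t : ℝ) : HasDerivAt (fun t => z t * cos (θ * t) - x t * sin (θ * t)) 0 t := by
      refine (((dz t).hasDerivAt.mul (dcos t)).sub
        ((dx t).hasDerivAt.mul (dsin t))).congr_deriv ?_
      rw [hx', hz']; ring
    intro t
    have := is_const_of_deriv_eq_zero (fun t => (hd t).differentiableAt) (fun t => (hd t).deriv) t 0
    simpa using this
  have h3 := h1 (2 * π)
  have h4 := h2 (2 * π)
  have h5 : x (2 * π) = x 0 := by simpa using hpx 0
  have h6 : z (2 * π) = z 0 := by simpa using hpz 0
  rw [h5, h6] at h3 h4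
  have h7 : cos (θ * (2 * π)) = 1 := by
    linear_combination (1 - cos (θ * (2 * π))) * hxz 0 + x 0 * h3 + z 0 * h4
  have h8 : -(1 : ℝ) < θ ∧ θ < 1 := by rcases hθR with rfl | rfl <;> constructor <;> linarith
  have h9 := (cos_eq_one_iff_of_lt_of_lt (by nlinarith [pi_pos]) (by nlinarith [pi_pos])).1 h7
  rcases mul_eq_zero.1 h9 with h | h
  · rcases hθR with h' | h' <;> linarith
  · linarith [pi_pos]

end Circle

end

theorem corollary3p6 (m : ℕ) (hm : 1 ≤ m) :
    (∀ R : ℝ, 0 < R →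
      ¬ ∃ f : SphereManifold m → (Fin (2 * m - 1 + 1) → ℝ),
        IsIsometricImmersion (sphereMetric m R)
            (pseudoForm (2 * m - 1 + 1) (m - 1 + 1)) (pseudoHyperbolic (2 * m - 1) (m - 1)) f ∧
          HasFlatNormalBundle m (pseudoForm (2 * m - 1 + 1) (m - 1 + 1)) f) ∧
    (∀ R : ℝ, 0 < R → R < 1 →
      ¬ ∃ f : SphereManifold m → (Fin (2 * m - 1 + 1) → ℝ),
        IsIsometricImmersion (sphereMetric m R)
            (pseudoForm (2 * m - 1 + 1) (m - 1)) (pseudoSphere (2 * m - 1) (m - 1)) f ∧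
          HasFlatNormalBundle m (pseudoForm (2 * m - 1 + 1) (m - 1)) f) := by
  rcases hm.eq_or_lt with rfl | hm
  · constructor
    · rintro R hR ⟨f, hf, -⟩
      obtain ⟨γ, hγ, hper, hQ, hspeed⟩ := hf.exists_periodic_curve
      have hd (i) (t : ℝ) : deriv (fun t => γ t i) t = deriv γ t i :=
        ((hasDerivAt_pi.1 (hγ.differentiable (by simp) t).hasDerivAt) i).deriv
      have hγi (i) : ContDiff ℝ ∞ fun t => γ t i := contDiff_pi.1 hγ i
      refine not_exists_periodic_curve_hyperbola (x := fun t => γ t (0 : Fin 2))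
        (z := fun t => γ t (1 : Fin 2)) ((hγi _).differentiable (by simp))
        ((hγi _).differentiable (by simp)) Real.two_pi_pos (fun t => congrFun (hper t) _)
        (fun t => ?_) (fun t => ?_)
      · have h1 : pseudoForm 2 1 (γ t) (γ t) = -1 := hQ t
        rw [pseudoForm_apply, Fin.sum_univ_two] at h1
        simp at h1
        linear_combination h1
      · have h1 : pseudoForm 2 1 (deriv γ t) (deriv γ t) = R ^ 2 := hspeed t
        rw [pseudoForm_apply, Fin.sum_univ_two] at h1
        simp at h1
        have h2 : -deriv (fun t => γ t (0 : Fin 2)) t ^ 2 + deriv (fun t => γ t (1 : Fin 2)) t ^ 2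
            = R ^ 2 := by
          rw [hd, hd]
          linear_combination h1
        rw [h2]
        positivity
    · rintro R hR hR1 ⟨f, hf, -⟩
      obtain ⟨γ, hγ, hper, hQ, hspeed⟩ := hf.exists_periodic_curve
      have hd (i) (t : ℝ) : deriv (fun t => γ t i) t = deriv γ t i :=
        ((hasDerivAt_pi.1 (hγ.differentiable (by simp) t).hasDerivAt) i).deriv
      have hγi (i) : ContDiff ℝ 1 fun t => γ t i := (contDiff_pi.1 hγ i).of_le (by simp)
      refine not_exists_periodic_curve_circle (x := fun t => γ t (0 : Fin 2))
        (z := fun t => γ t (1 : Fin 2)) (hγi _) (hγi _) (fun t => congrFun (hper t) _)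
        (fun t => congrFun (hper t) _) (fun t => ?_) hR hR1 (fun t => ?_)
      · have h1 : pseudoForm 2 0 (γ t) (γ t) = 1 := hQ t
        rw [pseudoForm_apply, Fin.sum_univ_two] at h1
        simp at h1
        linear_combination h1
      · have h1 : pseudoForm 2 0 (deriv γ t) (deriv γ t) = R ^ 2 := hspeed t
        rw [pseudoForm_apply, Fin.sum_univ_two] at h1
        simp at h1
        rw [hd, hd]
        linear_combination h1
  · constructor
    · rintro R hR ⟨f, hf, -⟩
      exact hf.false_of_two_le hm (by omega) hR (c := -1) (fun x hx => hx)
        (Or.inl ⟨by omega, by norm_num⟩)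
    · rintro R hR hR1 ⟨f, hf, -⟩
      exact hf.false_of_two_le hm (by omega) hR (c := 1) (fun x hx => hx)
        (Or.inr ⟨by omega, by nlinarith⟩)
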